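/- Let $B$ be a real separable Banach space with topological dual $B^*$, and let $X,X_1,X_2,\dots$ be i.i.d. $B$-valued random vectors with law $\mu$; put $S_n=\sum_{j=1}^n X_j$. Assume that $S_n/\sqrt n$ converges weakly to a nondegenerate probability measure $\gamma$ on $B$ (which is then necessarily a centered Gaussian measure), and that for every $f\in B^*$ there is $t_f>0$ with $E\,e^{t|f(X)|}<\infty$ for $0<|t|<t_f$. Let $(b_n)$ be positive constants with $b_n/n^{1/2}\to\infty$ and $b_n/n^{2/3}\to0$. For a probability measure $\nu$ on $B$ and $f\in B^*$ write $\hat\nu(f)=\int_B e^{f}\,d\nu$, and let $\lambda_\gamma(x)=\sup_{f\in B^*}[f(x)-\log\hat\gamma(f)]\in[0,\infty]$ for $x\in B$. Let $H_\gamma\subset B$ be the Hilbert space generating $\gamma$, i.e. the completion of $\{Sf: f\in B^*\}$, $Sf=\int_B x f(x)\,d\gamma(x)$, for the inner product $\langle Sf,Sh\rangle_\gamma=\int_B fh\,d\gamma$. Let $D\subset B$ be open and convex with $D\cap H_\gamma\neq\emptyset$ and $0\notin\overline D$. Let $a_0$ be the unique dominating point of $D$ with respect to $\gamma$, that is, the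 point $a_0\in\partial D$ such that $\lambda_\gamma(a_0)=\inf_D\lambda_\gamma=\inf_{\overline D}\lambda_\gamma<\infty$ and such that some $g\in B^*$ satisfies (a) $D\subset\{x: g(x)\ge g(a_0)\}$; (b) $\lambda_\gamma(a_0)=g(a_0)-\log\hat\gamma(g)$; (c) $a_0=\int_B x\,e^{g(x)-\log\hat\gamma(g)}\,d\gamma(x)$ as a Bochner integral. Let $f\in B^*$ satisfy $\sup\{f(z):\lambda_\gamma(z)\le\lambda_\gamma(a_0)\}=f(a_0)<f(x)$ for all $x\in D$, and let $t_0>0$ be such that $g=t_0f$ satisfies (a), (b), (c). For all large $n$ let $Z^{(n)},Z_{n,1},\dots,Z_{n,n}$ be i.i.d. $B$-valued with $$\frac{d\mathcal L(Z^{(n)})}{d\mu}(x)=\frac{e^{g(b_nx/n)}}{\hat\mu(b_ng/n)},\qquad T_n=\frac{b_n}{n}\sum_{j=1}^nZ_{n,j}.$$ Then for all large $n$ this law is well defined and has a mean (as a Bochner integral), and as $n\to\infty$: 1. $P(S_n/b_n\in D)\sim \exp\{-b_n^2\lambda_\gamma(a_0)/n\}\;E\big[\exp\{-g(T_n-ET_n)\}\,I\{T_n\in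 b_n^2D/n\}\big]$, meaning that the ratio of the two sides tends to $1$; 2. $E(Z^{(n)})=(b_n/n)\,a_0+O(b_n^2/n^2)$ in the norm of $B$; 3. $\sigma_g^2:=E\,g^2(X)>0$ and $$\limsup_{n\to\infty} n^{-1/2}\,b_n\,P(S_n/b_n\in D)\,\exp\{b_n^2\lambda_\gamma(a_0)/n\}\le(2\pi\sigma_g^2)^{-1/2}.$$ -/

import Mathlib

open MeasureTheory ProbabilityTheory Filter Topology Set
open scoped ENNReal Pointwise

namespace ModDev

noncomputable section

variable {B : Type*} [NormedAddCommGroup B] [NormedSpace ℝ B] [MeasurableSpace B]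

/-- The logarithm `log γ̂(f)` of the Laplace transform `γ̂(f) = ∫ exp (f x) dγ(x)` of a measure `γ`
at a continuous linear functional `f`, as an extended real. -/
def logLaplace (γ : Measure B) (f : StrongDual ℝ B) : EReal :=
  ENNReal.log (∫⁻ x, ENNReal.ofReal (Real.exp (f x)) ∂γ)

/-- The rate function `λ_γ(x) = sup_f (f x - log γ̂(f))`, the supremum being over the topological
dual. -/
def rate (γ : Measure B) (x : B) : EReal :=
  ⨆ f : StrongDual ℝ B, ((f x : ℝ) : EReal) - logLaplace γ f

/-- The vector `S f = ∫ f(x) x dγ(x)` of `B`, a Bochner integral. -/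
def covVec (γ : Measure B) (f : StrongDual ℝ B) : B :=
  ∫ x, f x • x ∂γ

/-- The Hilbert space `H_γ ⊆ B` generating the centered Gaussian measure `γ`: the completion of
`{S f | f ∈ B*}` for the inner product `⟨S f, S h⟩ = ∫ f h dγ`, realized inside `B` as the set of
limits in `B` of those sequences `S (f k)` that are Cauchy for the norm of this inner product. -/
def generatingSpace (γ : Measure B) : Set B :=
  {x | ∃ f : ℕ → StrongDual ℝ B,
    (∀ ε : ℝ, 0 < ε → ∃ N : ℕ, ∀ j ≥ N, ∀ k ≥ N, ∫ y, (f j y - f k y) ^ 2 ∂γ < ε) ∧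
    Tendsto (fun k => covVec γ (f k)) atTop (𝓝 x)}

/-- The standing assumptions on the set `D`. -/
structure IsAdmissible (γ : Measure B) (D : Set B) : Prop where
  isOpen : IsOpen D
  convex : Convex ℝ D
  inter_nonempty : (D ∩ generatingSpace γ).Nonempty
  zero_notMem : (0 : B) ∉ closure D

/-- `g` is a functional belonging to the dominating point `a` of `D`: it supports `D` at `a`, the
supremum defining `λ_γ(a)` is attained at `g`, and `a` is the mean of `γ` tilted by `g`. -/
structure IsDominatingFunctional (γ : Measure B) (D : Set B) (a : B) (g : StrongDual ℝ B) :
    Prop where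
  subset_halfSpace : D ⊆ {x | g a ≤ g x}
  rate_eq : rate γ a = ((g a : ℝ) : EReal) - logLaplace γ g
  integrable : Integrable (fun x => Real.exp (g x - (logLaplace γ g).toReal) • x) γ
  eq_integral : a = ∫ x, Real.exp (g x - (logLaplace γ g).toReal) • x ∂γ

/-- `a` is a dominating point of `D` with respect to `γ`. -/
structure IsDominatingPoint (γ : Measure B) (D : Set B) (a : B) : Prop where
  mem_frontier : a ∈ frontier D
  rate_eq_iInf : rate γ a = ⨅ x ∈ D, rate γ x
  rate_eq_iInf_closure : rate γ a = ⨅ x ∈ closure D, rate γ x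
  rate_lt_top : rate γ a < ⊤
  exists_functional : ∃ g : StrongDual ℝ B, IsDominatingFunctional γ D a g

/-- `f` separates `D` from the level set `{z | λ_γ(z) ≤ λ_γ(a)}` at the point `a`. -/
def Separates (γ : Measure B) (D : Set B) (a : B) (f : StrongDual ℝ B) : Prop :=
  IsLUB (f '' {z | rate γ z ≤ rate γ a}) (f a) ∧ ∀ x ∈ D, f a < f x

/-- The exponentially tilted law `dρ(x) = exp (g (s x)) / μ̂(s g) dμ(x)`. -/
def tiltedLaw (μ : Measure B) (g : StrongDual ℝ B) (s : ℝ) : Measure B :=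
  μ.tilted (fun x => g (s • x))

/-- `T = s (z₁ + ⋯ + zₙ)`, as a function on the sample space `Bⁿ`. -/
def scaledSum (n : ℕ) (s : ℝ) (z : Fin n → B) : B :=
  s • ∑ j, z j

/-- The law of `n` independent vectors, each with law `tiltedLaw μ g s`. -/
def tiltedPower (μ : Measure B) (g : StrongDual ℝ B) (s : ℝ) (n : ℕ) : Measure (Fin n → B) :=
  Measure.pi (fun _ : Fin n => tiltedLaw μ g s)

/-- The expectation `E[exp {-g (T - E T)} I{T ∈ A}]`, where `T = s (Z₁ + ⋯ + Zₙ)` and the `Zⱼ` are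
independent with law `tiltedLaw μ g s`. -/
def tiltedExpectation (μ : Measure B) (g : StrongDual ℝ B) (s : ℝ) (n : ℕ) (A : Set B) : ℝ :=
  ∫ z in {z : Fin n → B | scaledSum n s z ∈ A},
    Real.exp (-g (scaledSum n s z - ∫ w, scaledSum n s w ∂(tiltedPower μ g s n)))
      ∂(tiltedPower μ g s n)

end

end ModDev

/-!
Let `K` be the cumulant generating function of `g(X)` and `s = b / n`. Multiplying the law of
`(X₁, …, Xₙ)` by the density of its exponential tilt gives an identity without error term,
`P(S / b ∈ D) = exp (n (K(s) - s K'(s))) E[exp (-g(T - E T)) I{T ∈ b² D / n}]`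
(`measureReal_eq_exp_mul_tiltedExpectation`). As `K(s) - s K'(s) = -s² σ² / 2 + O(s³)` and
`n s³ = b³ / n² → 0`, the exponential factor is `exp (-n s² σ² / 2) (1 + o(1))`. By the
Cameron–Martin formula for `γ` the dominating point is `a₀ = covVec γ g`, whence
`λ_γ(a₀) = σ² / 2` with `σ² = E g(X)²`, and
`n s² σ² / 2 = b² λ_γ(a₀) / n`. For the ratio of the two sides to tend to `1` the probabilities must
also be nonzero: cut `n` into about `n s²` blocks of length about `s⁻²`. With positive probability
every normalised block sum lies close to a given point of `D ∩ H_γ`, by the central limit theorem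
and because `γ` charges the neighbourhoods of such a point
(`eventually_measure_sum_mem_pos`, `measure_pos_of_inter_generatingSpace`).

The mean of the tilted law is expanded by means of Hölder's inequality: the functional `g` has
exponential moments, and it is enough to know `E ‖X‖ ^ (3/2) < ∞`. This moment is a consequence of
the central limit theorem alone, which by Ottaviani's inequality forces
`P(‖X‖ > u) = O(u ^ (-2))` (`memLp_three_halves`).

For the upper bound, `D` lies in the half-space `g ≥ g(a₀)` and `g(E T) = n s² σ² + O(n s³)`, so
`T ∈ b² D / n` forces `g(T - E T) ≥ -o(1)`. The expectation is then at most about `∫₀^∞ exp (-w) dw`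
times a bound for the density of `g(T)`, which has variance about `n s² σ²`: this explains the
constant `(2 π n s² σ²) ^ (-1/2)`. No density is available, but after convolution with a Gaussian
law of small fixed variance the density is bounded through Fourier inversion. The characteristic
function of one tilted summand is dominated by `exp (-(1 - η) σ² t² / 2)` on a fixed interval
`|t| ≤ c`, uniformly in `s`, and the characteristic function of `g(T)` at `u` involves it at
`t = s u`; the frequencies `|u| > c / s` have mass `O(s²)` under the Gaussian smoothing weight,
which is negligible against `(n s²) ^ (-1/2)` because `n s³ → 0`. Thus neither a Berry–Esseen
estimate nor a condition on the lattice structure of `g(X)` is needed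
(`eventually_mul_tiltedExpectation_le`).
-/

namespace ModDev

/-! ### Sums of independent vectors and Ottaviani's inequality -/

section Sums

variable {B : Type*} [NormedAddCommGroup B]
  [SecondCountableTopology B] [MeasurableSpace B] [BorelSpace B]
  {Ω : Type*} {X : ℕ → Ω → B}

lemma measurable_sum_range_iSup_comap {k i : ℕ} (hik : i ≤ k) :
    Measurable[⨆ j ∈ Iio k, MeasurableSpace.comap (X j) inferInstance]
      (fun ω => ∑ j ∈ Finset.range i, X j ω) := by
  refine @Finset.measurable_fun_sum B ℕ Ω _ _ _ (_) _ _ fun j hj => ?_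
  have hj' : j ∈ Iio k := (Finset.mem_range.1 hj).trans_le hik
  exact (comap_measurable (X j)).mono
    (le_iSup₂ (f := fun j (_ : j ∈ Iio k) =>
      MeasurableSpace.comap (X j) inferInstance) j hj') le_rfl

variable [MeasurableSpace Ω] {P : Measure Ω}

/-- The sum over a block of indices has the law of the sum over the initial block of the same
length. -/
lemma identDistrib_sum_Ico (hindep : iIndepFun X P)
    (hident : ∀ j, IdentDistrib (X j) (X 0) P P) (k m : ℕ) :
    IdentDistrib (fun ω => ∑ j ∈ Finset.Ico k (k + m), X j ω)
      (fun ω => ∑ j ∈ Finset.range m, X j ω) P P := by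
  have h1 : IdentDistrib (fun ω (i : Fin m) => X (k + i) ω) (fun ω (i : Fin m) => X i ω) P P :=
    IdentDistrib.pi (fun i => (hident _).trans (hident _).symm)
      (hindep.precomp (g := fun i : Fin m => k + (i : ℕ))
        (fun a b h => Fin.ext (Nat.add_left_cancel h)))
      (hindep.precomp (g := fun i : Fin m => (i : ℕ)) (fun a b h => Fin.ext h))
  have h2 := h1.comp (u := fun z : Fin m → B => ∑ i, z i) (by fun_prop)
  convert! h2 using 1
  · ext ω
    simp [Finset.sum_Ico_eq_sum_range, Finset.sum_range]
  · ext ω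
    simp [Finset.sum_range]

/-- Events determined by the variables with index below `k` are independent of events determined
by the sum of the variables with index in `[k, n)`. -/
lemma measure_inter_sum_Ico (hX : ∀ j, Measurable (X j)) (hindep : iIndepFun X P) (k n : ℕ)
    {A : Set Ω}
    (hA : MeasurableSet[⨆ j ∈ Iio k, MeasurableSpace.comap (X j) inferInstance] A)
    {C : Set B} (hC : MeasurableSet C) :
    P (A ∩ {ω | ∑ j ∈ Finset.Ico k n, X j ω ∈ C}) =
      P A * P {ω | ∑ j ∈ Finset.Ico k n, X j ω ∈ C} := by
  have h := indep_iSup_of_disjoint (m := fun j => MeasurableSpace.comap (X j) inferInstance)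
    (fun j => (hX j).comap_le) hindep (S := Iio k) (T := Ici k)
    (Set.disjoint_left.2 fun a h1 h2 => (mem_Iio.1 h1).not_ge (mem_Ici.1 h2))
  refine (Indep_iff _ _ _).1 h _ _ hA ?_
  have hm : Measurable[⨆ j ∈ Ici k, MeasurableSpace.comap (X j) inferInstance]
      (fun ω => ∑ j ∈ Finset.Ico k n, X j ω) := by
    refine @Finset.measurable_fun_sum B ℕ Ω _ _ _ (_) _ _ fun j hj => ?_
    have hj' : j ∈ Ici k := (Finset.mem_Ico.1 hj).1
    exact (comap_measurable (X j)).mono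
      (le_iSup₂ (f := fun j (_ : j ∈ Ici k) =>
        MeasurableSpace.comap (X j) inferInstance) j hj') le_rfl
  exact hm hC

/-- **Ottaviani's inequality**: if every tail sum is small with probability at least `c`, then the
maximal partial sum is controlled by the last one. -/
lemma measure_exists_lt_norm_sum_mul_le (hX : ∀ j, Measurable (X j)) (hindep : iIndepFun X P)
    (n : ℕ) (t : ℝ) (c : ℝ≥0∞)
    (hc : ∀ k ≤ n, c ≤ P {ω | ‖∑ j ∈ Finset.Ico k n, X j ω‖ ≤ t}) :
    P {ω | ∃ k ≤ n, 2 * t < ‖∑ j ∈ Finset.range k, X j ω‖} * c ≤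
      P {ω | t < ‖∑ j ∈ Finset.range n, X j ω‖} := by
  -- `F k` is the event that the partial sums leave the ball of radius `2 t` at time `k`
  let F : ℕ → Set Ω := fun k => {ω | 2 * t < ‖∑ j ∈ Finset.range k, X j ω‖} ∩
    ⋂ i ∈ Finset.range k, {ω | ‖∑ j ∈ Finset.range i, X j ω‖ ≤ 2 * t}
  have hFm : ∀ k, MeasurableSet[⨆ j ∈ Iio k, MeasurableSpace.comap (X j) inferInstance] (F k) := by
    intro k
    refine @MeasurableSet.inter Ω (_) _ _ ?_ ?_
    · exact measurable_sum_range_iSup_comap le_rfl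
        (measurableSet_lt measurable_const measurable_norm)
    · refine @Finset.measurableSet_biInter Ω ℕ (_) _ _ fun i hi => ?_
      exact measurable_sum_range_iSup_comap (Finset.mem_range.1 hi).le
        (measurableSet_le measurable_norm measurable_const)
  have hFm' : ∀ k, MeasurableSet (F k) := fun k =>
    (iSup₂_le fun j _ => (hX j).comap_le :
      (⨆ j ∈ Iio k, MeasurableSpace.comap (X j) inferInstance) ≤ _) _ (hFm k)
  have hS : ∀ k, Measurable fun ω => ∑ j ∈ Finset.range k, X j ω := fun k => by fun_prop
  have hdisj : Pairwise (Function.onFun Disjoint F) := by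
    have key : ∀ i j, i < j → Disjoint (F i) (F j) := by
      intro i j hij
      refine Set.disjoint_left.2 fun ω h1 h2 => ?_
      have h3 := h2.2
      simp only [mem_iInter, Finset.mem_range] at h3
      exact (mem_ofPred.1 h1.1).not_ge (h3 i hij)
    intro i j hij
    rcases lt_or_gt_of_ne hij with h | h
    · exact key i j h
    · exact (key j i h).symm
  have hunion : {ω | ∃ k ≤ n, 2 * t < ‖∑ j ∈ Finset.range k, X j ω‖} ⊆
      ⋃ k ∈ Finset.range (n + 1), F k := by
    rintro ω ⟨k, hk, hkt⟩
    classical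
    have hex : ∃ k, 2 * t < ‖∑ j ∈ Finset.range k, X j ω‖ := ⟨k, hkt⟩
    refine mem_iUnion₂.2 ⟨Nat.find hex, Finset.mem_range.2
      (Nat.lt_succ_of_le ((Nat.find_min' hex hkt).trans hk)), Nat.find_spec hex, ?_⟩
    simp only [mem_iInter, Finset.mem_range]
    intro i hi
    exact not_lt.1 (Nat.find_min hex hi)
  calc P {ω | ∃ k ≤ n, 2 * t < ‖∑ j ∈ Finset.range k, X j ω‖} * c
      ≤ (∑ k ∈ Finset.range (n + 1), P (F k)) * c := by
        gcongr
        exact (measure_mono hunion).trans (measure_biUnion_finset_le _ _)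
    _ = ∑ k ∈ Finset.range (n + 1), P (F k) * c := Finset.sum_mul _ _ _
    _ ≤ ∑ k ∈ Finset.range (n + 1), P (F k ∩ {ω | t < ‖∑ j ∈ Finset.range n, X j ω‖}) := by
        refine Finset.sum_le_sum fun k hk => ?_
        have hkn : k ≤ n := Nat.lt_succ_iff.1 (Finset.mem_range.1 hk)
        calc P (F k) * c
            ≤ P (F k) * P {ω | ‖∑ j ∈ Finset.Ico k n, X j ω‖ ≤ t} := by gcongr; exact hc k hkn
          _ = P (F k ∩ {ω | ‖∑ j ∈ Finset.Ico k n, X j ω‖ ≤ t}) :=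
              (measure_inter_sum_Ico hX hindep k n (hFm k) (C := {x | ‖x‖ ≤ t})
                (measurableSet_le measurable_norm measurable_const)).symm
          _ ≤ _ := by
              refine measure_mono fun ω hω => ⟨hω.1, ?_⟩
              have h1 : 2 * t < ‖∑ j ∈ Finset.range k, X j ω‖ := hω.1.1
              have h2 : ‖∑ j ∈ Finset.Ico k n, X j ω‖ ≤ t := hω.2
              have h3 := Finset.sum_range_add_sum_Ico (fun j => X j ω) hkn
              have h4 := norm_sub_norm_le (∑ j ∈ Finset.range k, X j ω)
                (-∑ j ∈ Finset.Ico k n, X j ω)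
              rw [norm_neg, sub_neg_eq_add, h3] at h4
              rw [mem_ofPred]
              linarith
    _ = P (⋃ k ∈ Finset.range (n + 1), F k ∩ {ω | t < ‖∑ j ∈ Finset.range n, X j ω‖}) := by
        refine (measure_biUnion_finset ?_ fun k _ => ?_).symm
        · intro i _ j _ hij
          exact (hdisj hij).mono inter_subset_left inter_subset_left
        · exact (hFm' k).inter (measurableSet_lt measurable_const (hS n).norm)
    _ ≤ _ := measure_mono (iUnion₂_subset fun k _ => inter_subset_right)

end Sums

/-! ### Tails and moments under the central limit theorem -/

section Tails

variable {B : Type*} [NormedAddCommGroup B] [NormedSpace ℝ B]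
  [MeasurableSpace B] [BorelSpace B]
  {Ω : Type*} [MeasurableSpace Ω] {P : Measure Ω} [IsProbabilityMeasure P] {X : ℕ → Ω → B}
  {γ : Measure B} [IsProbabilityMeasure γ]

/-- Open sets charged by the limit law are eventually charged by the normalised sums. -/
lemma eventually_lt_measure_of_isOpen
    (hclt : TendstoInDistribution
      (fun (n : ℕ) (ω : Ω) => (Real.sqrt n)⁻¹ • ∑ j ∈ Finset.range n, X j ω)
      atTop (id : B → B) (fun _ => P) γ) {U : Set B} (hU : IsOpen U) {c : ℝ≥0∞} (hc : c < γ U) :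
    ∀ᶠ n : ℕ in atTop, c < P {ω | (Real.sqrt n)⁻¹ • ∑ j ∈ Finset.range n, X j ω ∈ U} := by
  have h := ProbabilityMeasure.le_liminf_measure_open_of_tendsto hclt.tendsto hU
  simp only [ProbabilityMeasure.coe_mk, Measure.map_id] at h
  filter_upwards [eventually_lt_of_lt_liminf (hc.trans_le h)] with n hn
  rwa [Measure.map_apply_of_aemeasurable (hclt.forall_aemeasurable n) hU.measurableSet] at hn

/-- Tightness of the normalised sums. -/
lemma exists_eventually_norm_sum_le
    (hclt : TendstoInDistribution
      (fun (n : ℕ) (ω : Ω) => (Real.sqrt n)⁻¹ • ∑ j ∈ Finset.range n, X j ω)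
      atTop (id : B → B) (fun _ => P) γ) {c : ℝ≥0∞} (hc : c < 1) :
    ∃ R : ℝ, 0 < R ∧ ∀ᶠ n : ℕ in atTop,
      c < P {ω | ‖∑ j ∈ Finset.range n, X j ω‖ ≤ R * Real.sqrt n} := by
  have h1 : Tendsto (fun k : ℕ => γ (Metric.ball (0 : B) k)) atTop (𝓝 (γ univ)) := by
    rw [← Metric.iUnion_ball_nat (0 : B)]
    exact tendsto_measure_iUnion_atTop fun i j hij =>
      Metric.ball_subset_ball (by exact_mod_cast hij)
  rw [measure_univ] at h1
  obtain ⟨k, hk, hk0⟩ := ((h1.eventually (lt_mem_nhds hc)).and (eventually_gt_atTop 0)).exists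
  refine ⟨k, by exact_mod_cast hk0, ?_⟩
  filter_upwards [eventually_lt_measure_of_isOpen hclt Metric.isOpen_ball hk,
    eventually_gt_atTop 0] with n hn hn0
  refine hn.trans_le (measure_mono fun ω hω => ?_)
  have hs : 0 < Real.sqrt n := Real.sqrt_pos.2 (by exact_mod_cast hn0)
  have h2 : ‖(Real.sqrt n)⁻¹ • ∑ j ∈ Finset.range n, X j ω‖ < k := by simpa using hω
  rw [norm_smul, norm_inv, Real.norm_of_nonneg hs.le, inv_mul_lt_iff₀ hs] at h2
  rw [mem_ofPred]
  linarith

variable [SecondCountableTopology B]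

/-- The central limit theorem forces tails of order `u ^ (-2)`: the maximal summand is dominated by
the maximal partial sum, which Ottaviani's inequality controls. -/
lemma exists_eventually_measure_norm_gt_le (hX : ∀ j, Measurable (X j)) (hindep : iIndepFun X P)
    (hident : ∀ j, IdentDistrib (X j) (X 0) P P)
    (hclt : TendstoInDistribution
      (fun (n : ℕ) (ω : Ω) => (Real.sqrt n)⁻¹ • ∑ j ∈ Finset.range n, X j ω)
      atTop (id : B → B) (fun _ => P) γ) :
    ∃ R : ℝ, 0 < R ∧ ∀ᶠ n : ℕ in atTop,
      P.real {ω | R * Real.sqrt n < ‖X 0 ω‖} ≤ 1 / n := by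
  obtain ⟨R, hR, hRn⟩ := exists_eventually_norm_sum_le hclt (c := 3 / 4)
    (by rw [ENNReal.div_lt_iff] <;> norm_num)
  obtain ⟨N, hN⟩ := eventually_atTop.1 hRn
  have hS : ∀ k, Measurable fun ω => ∑ j ∈ Finset.range k, X j ω := fun k => by fun_prop
  -- the finitely many sums with fewer than `N` terms are tight as well
  have hsmall : ∀ m, ∀ᶠ n : ℕ in atTop,
      3 / 4 < P {ω | ‖∑ j ∈ Finset.range m, X j ω‖ ≤ R * Real.sqrt n} := by
    intro m
    have hlim : Tendsto (fun n : ℕ => R * Real.sqrt n) atTop atTop :=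
      (Real.tendsto_sqrt_atTop.comp tendsto_natCast_atTop_atTop).const_mul_atTop hR
    have hmono : Monotone fun n : ℕ => {ω | ‖∑ j ∈ Finset.range m, X j ω‖ ≤ R * Real.sqrt n} := by
      intro a b hab ω hω
      refine le_trans (mem_ofPred.1 hω) ?_
      gcongr
    have hU : (⋃ n : ℕ, {ω | ‖∑ j ∈ Finset.range m, X j ω‖ ≤ R * Real.sqrt n}) = univ := by
      refine eq_univ_of_forall fun ω => mem_iUnion.2 ?_
      exact (hlim.eventually_ge_atTop _).exists
    have h1 := tendsto_measure_iUnion_atTop (μ := P) hmono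
    rw [hU, measure_univ] at h1
    exact h1.eventually (lt_mem_nhds (by rw [ENNReal.div_lt_iff] <;> norm_num))
  have hsmall' : ∀ᶠ n : ℕ in atTop, ∀ m ∈ Finset.range N,
      3 / 4 < P {ω | ‖∑ j ∈ Finset.range m, X j ω‖ ≤ R * Real.sqrt n} :=
    (Filter.eventually_all_finset _).2 fun m _ => hsmall m
  refine ⟨4 * R, by positivity, ?_⟩
  filter_upwards [hsmall', eventually_ge_atTop N, eventually_gt_atTop 0] with n hn hnN hn0
  set t := R * Real.sqrt n with ht
  have hall : ∀ m ≤ n, 3 / 4 < P {ω | ‖∑ j ∈ Finset.range m, X j ω‖ ≤ t} := by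
    intro m hm
    rcases lt_or_ge m N with h | h
    · exact hn m (Finset.mem_range.2 h)
    · refine (hN m h).trans_le (measure_mono fun ω hω => le_trans (mem_ofPred.1 hω) ?_)
      rw [ht]
      gcongr
  have hott := measure_exists_lt_norm_sum_mul_le hX hindep n t (3 / 4) (by
    intro k hk
    have h1 := identDistrib_sum_Ico hindep hident k (n - k)
    rw [Nat.add_sub_cancel' hk] at h1
    have h2 := h1.measure_mem_eq (s := {x | ‖x‖ ≤ t})
      (measurableSet_le measurable_norm measurable_const)
    exact (hall _ (Nat.sub_le _ _)).le.trans h2.ge)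
  have hlast : P.real {ω | t < ‖∑ j ∈ Finset.range n, X j ω‖} ≤ 1 / 4 := by
    have h1 := hall n le_rfl
    have h2 : {ω | t < ‖∑ j ∈ Finset.range n, X j ω‖} =
        {ω | ‖∑ j ∈ Finset.range n, X j ω‖ ≤ t}ᶜ := by ext; simp
    rw [h2, probReal_compl_eq_one_sub (measurableSet_le (hS n).norm measurable_const)]
    have h3 := ENNReal.toReal_mono (measure_ne_top _ _) h1.le
    norm_num at h3
    rw [Measure.real]
    linarith
  have hmax : P.real {ω | ∃ k ≤ n, 2 * t < ‖∑ j ∈ Finset.range k, X j ω‖} ≤ 1 / 3 := by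
    have h1 := ENNReal.toReal_mono (measure_ne_top _ _) hott
    rw [ENNReal.toReal_mul] at h1
    norm_num at h1
    have h2 : (P {ω | t < ‖∑ j ∈ Finset.range n, X j ω‖}).toReal ≤ 1 / 4 := hlast
    rw [Measure.real]
    linarith
  set q := P.real {ω | 4 * R * Real.sqrt n < ‖X 0 ω‖} with hq
  have hpow : (1 - q) ^ n = P.real (⋂ j ∈ Finset.range n, X j ⁻¹' {x | ‖x‖ ≤ 4 * t}) := by
    have hmeas : MeasurableSet {x : B | ‖x‖ ≤ 4 * t} :=
      measurableSet_le measurable_norm measurable_const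
    have h1 := hindep.measure_inter_preimage_eq_mul (Finset.range n)
      (sets := fun _ => {x | ‖x‖ ≤ 4 * t}) (fun _ _ => hmeas)
    rw [Measure.real, h1, ENNReal.toReal_prod,
      Finset.prod_congr rfl fun j _ => congrArg ENNReal.toReal ((hident j).measure_mem_eq hmeas),
      Finset.prod_const, Finset.card_range]
    congr 1
    have h2 : {ω | 4 * R * Real.sqrt n < ‖X 0 ω‖} = (X 0 ⁻¹' {x | ‖x‖ ≤ 4 * t})ᶜ := by
      ext; simp [ht, mul_assoc]
    rw [hq, h2, probReal_compl_eq_one_sub (hX 0 hmeas), Measure.real]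
    ring
  have hge : 2 / 3 ≤ (1 - q) ^ n := by
    have hm : MeasurableSet {ω | ∃ k ≤ n, 2 * t < ‖∑ j ∈ Finset.range k, X j ω‖} := by
      simp only [← exists_prop, ofPred_exists]
      exact .iUnion fun k => .iUnion fun _ => measurableSet_lt measurable_const (hS k).norm
    have h1 : 2 / 3 ≤ P.real {ω | ∃ k ≤ n, 2 * t < ‖∑ j ∈ Finset.range k, X j ω‖}ᶜ := by
      rw [probReal_compl_eq_one_sub hm]
      linarith
    rw [hpow]
    refine h1.trans (measureReal_mono fun ω hω => ?_)
    simp only [mem_compl_iff, mem_ofPred, not_exists, not_and, not_lt] at hω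
    simp only [mem_iInter, mem_preimage, mem_ofPred, Finset.mem_range]
    intro j hj
    have h2 := hω j hj.le
    have h3 := hω (j + 1) hj
    have h4 : X j ω = ∑ i ∈ Finset.range (j + 1), X i ω - ∑ i ∈ Finset.range j, X i ω := by
      rw [Finset.sum_range_succ]; abel
    rw [h4]
    linarith [norm_sub_le (∑ i ∈ Finset.range (j + 1), X i ω) (∑ i ∈ Finset.range j, X i ω)]
  have hq0 : 0 ≤ q := measureReal_nonneg
  have hq1 : q ≤ 1 := measureReal_le_one
  have hn0' : (0 : ℝ) < n := by exact_mod_cast hn0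
  have h5 : (1 - q) ^ n * (1 + n * q) ≤ 1 := by
    have h6 : 1 + n * q ≤ (1 + q) ^ n := one_add_mul_le_pow (by linarith) n
    calc (1 - q) ^ n * (1 + n * q) ≤ (1 - q) ^ n * (1 + q) ^ n := by gcongr
      _ = (1 - q ^ 2) ^ n := by rw [← mul_pow]; ring
      _ ≤ 1 := pow_le_one₀ (by nlinarith) (by nlinarith)
  rw [le_div_iff₀ hn0']
  have h7 : 2 / 3 * (1 + n * q) ≤ 1 := le_trans (by gcongr) h5
  linarith

/-- A random vector obeying the central limit theorem has moments of every order below two; the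
order `3 / 2` is the one conjugate to `3`. -/
lemma memLp_three_halves (hX : ∀ j, Measurable (X j)) (hindep : iIndepFun X P)
    (hident : ∀ j, IdentDistrib (X j) (X 0) P P)
    (hclt : TendstoInDistribution
      (fun (n : ℕ) (ω : Ω) => (Real.sqrt n)⁻¹ • ∑ j ∈ Finset.range n, X j ω)
      atTop (id : B → B) (fun _ => P) γ) :
    MemLp (X 0) (3 / 2) P := by
  obtain ⟨R, hR, hRn⟩ := exists_eventually_measure_norm_gt_le hX hindep hident hclt
  obtain ⟨N, hN⟩ := eventually_atTop.1 hRn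
  -- comparison of `u` with `R √n` for `n = ⌊(u / R) ^ 2⌋₊`
  have htail : ∃ T : ℝ, 0 < T ∧ ∀ u, T ≤ u →
      P.real {ω | u < ‖X 0 ω‖} ≤ 2 * R ^ 2 * u ^ (-2 : ℝ) := by
    refine ⟨R * Real.sqrt (N + 1), by positivity, fun u hu => ?_⟩
    have hu0 : 0 < u := lt_of_lt_of_le (by positivity) hu
    have h1 : (N : ℝ) + 1 ≤ (u / R) ^ 2 := by
      have h2 : Real.sqrt (N + 1) ≤ u / R := by rw [le_div_iff₀ hR]; linarith
      calc (N : ℝ) + 1 = Real.sqrt (N + 1) ^ 2 := (Real.sq_sqrt (by positivity)).symm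
        _ ≤ _ := by gcongr
    set n := ⌊(u / R) ^ 2⌋₊ with hn
    have hnle : (n : ℝ) ≤ (u / R) ^ 2 := Nat.floor_le (by positivity)
    have hnlt : (u / R) ^ 2 < n + 1 := Nat.lt_floor_add_one _
    have hNn : N + 1 ≤ n := Nat.le_floor (by exact_mod_cast h1)
    have hn1 : (1 : ℝ) ≤ n := by exact_mod_cast (Nat.le_add_left 1 N).trans hNn
    have h3 : R * Real.sqrt n ≤ u := by
      have : Real.sqrt n ≤ u / R := Real.sqrt_le_iff.2 ⟨by positivity, hnle⟩
      rw [le_div_iff₀ hR] at this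
      linarith
    calc P.real {ω | u < ‖X 0 ω‖} ≤ P.real {ω | R * Real.sqrt n < ‖X 0 ω‖} :=
          measureReal_mono fun ω hω => lt_of_le_of_lt h3 hω
      _ ≤ 1 / n := hN n ((Nat.le_succ N).trans hNn)
      _ ≤ 2 * R ^ 2 * u ^ (-2 : ℝ) := by
          rw [Real.rpow_neg hu0.le, div_le_iff₀ (by linarith), Real.rpow_two]
          have h4 : (u / R) ^ 2 ≤ 2 * n := by linarith
          rw [div_pow, div_le_iff₀ (by positivity)] at h4
          have : 0 < u ^ 2 := by positivity
          field_simp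
          linarith
  obtain ⟨T, hT, hTu⟩ := htail
  have hm : AEMeasurable (fun ω => ‖X 0 ω‖) P := (hX 0).norm.aemeasurable
  have hfin : ∫⁻ ω, ENNReal.ofReal (‖X 0 ω‖ ^ (3 / 2 : ℝ)) ∂P < ∞ := by
    rw [lintegral_rpow_eq_lintegral_meas_lt_mul P (ae_of_all _ fun _ => norm_nonneg _) hm
      (by norm_num : (0 : ℝ) < 3 / 2)]
    refine ENNReal.mul_lt_top ENNReal.ofReal_lt_top ?_
    rw [← Ioc_union_Ioi_eq_Ioi hT.le]
    refine (lintegral_union_le _ _ _).trans_lt (ENNReal.add_lt_top.2 ⟨?_, ?_⟩)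
    · calc ∫⁻ t in Ioc 0 T, P {a | t < ‖X 0 a‖} * ENNReal.ofReal (t ^ ((3 / 2 : ℝ) - 1))
          ≤ ∫⁻ _ in Ioc 0 T, ENNReal.ofReal (T ^ ((3 / 2 : ℝ) - 1)) := by
            refine setLIntegral_mono measurable_const fun t ht => ?_
            calc _ ≤ 1 * ENNReal.ofReal (t ^ ((3 / 2 : ℝ) - 1)) := by gcongr; exact prob_le_one
              _ ≤ _ := by
                rw [one_mul]
                exact ENNReal.ofReal_le_ofReal
                  (Real.rpow_le_rpow ht.1.le ht.2 (by norm_num))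
        _ < ∞ := by
            rw [setLIntegral_const]
            exact ENNReal.mul_lt_top ENNReal.ofReal_lt_top (by simp)
    · calc ∫⁻ t in Ioi T, P {a | t < ‖X 0 a‖} * ENNReal.ofReal (t ^ ((3 / 2 : ℝ) - 1))
          ≤ ∫⁻ t in Ioi T, ENNReal.ofReal (2 * R ^ 2 * t ^ (-(3 / 2) : ℝ)) := by
            refine setLIntegral_mono (by fun_prop) fun t ht => ?_
            have ht0 : 0 < t := hT.trans ht
            have h1 : P {a | t < ‖X 0 a‖} ≤ ENNReal.ofReal (2 * R ^ 2 * t ^ (-2 : ℝ)) := by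
              rw [← ENNReal.ofReal_toReal (measure_ne_top P _)]
              exact ENNReal.ofReal_le_ofReal (hTu t (mem_Ioi.1 ht).le)
            calc _ ≤ ENNReal.ofReal (2 * R ^ 2 * t ^ (-2 : ℝ)) *
                  ENNReal.ofReal (t ^ ((3 / 2 : ℝ) - 1)) := by gcongr
              _ = _ := by
                rw [← ENNReal.ofReal_mul (by positivity), mul_assoc, ← Real.rpow_add ht0]
                norm_num
        _ < ∞ := by
            have h2 : IntegrableOn (fun t : ℝ => 2 * R ^ 2 * t ^ (-(3 / 2) : ℝ)) (Ioi T) :=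
              (integrableOn_Ioi_rpow_of_lt (by norm_num) hT).const_mul _
            exact h2.lintegral_lt_top
  refine ⟨(hX 0).aestronglyMeasurable, ?_⟩
  have h32 : ((3 / 2 : ℝ≥0∞)).toReal = 3 / 2 := by simp
  rw [eLpNorm_lt_top_iff_lintegral_rpow_enorm_lt_top (by simp)
    (ENNReal.div_ne_top (by simp) (by simp)), h32]
  convert! hfin using 3 with ω
  rw [← ofReal_norm, ENNReal.ofReal_rpow_of_nonneg (norm_nonneg _) (by norm_num)]

/-- The summands in a central limit theorem without centring have mean zero: otherwise the law of
large numbers would contradict tightness. -/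
lemma integral_eq_zero_of_clt [CompleteSpace B] (hX : ∀ j, Measurable (X j))
    (hindep : iIndepFun X P)
    (hident : ∀ j, IdentDistrib (X j) (X 0) P P)
    (hclt : TendstoInDistribution
      (fun (n : ℕ) (ω : Ω) => (Real.sqrt n)⁻¹ • ∑ j ∈ Finset.range n, X j ω)
      atTop (id : B → B) (fun _ => P) γ) :
    ∫ ω, X 0 ω ∂P = 0 := by
  have hint : Integrable (X 0) P :=
    (memLp_three_halves hX hindep hident hclt).integrable (by
      rw [ENNReal.le_div_iff_mul_le] <;> norm_num)
  have hlln := strong_law_ae X hint (fun i j hij => hindep.indepFun hij) hident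
  have hmeas : TendstoInMeasure P (fun (n : ℕ) ω => (n : ℝ)⁻¹ • ∑ j ∈ Finset.range n, X j ω) atTop
      (fun _ => ∫ ω, X 0 ω ∂P) :=
    tendstoInMeasure_of_tendsto_ae (fun n => by
      have : Measurable fun ω => (n : ℝ)⁻¹ • ∑ j ∈ Finset.range n, X j ω := by fun_prop
      exact this.aestronglyMeasurable) hlln
  by_contra hne
  set e := ‖∫ ω, X 0 ω ∂P‖ with he
  have he0 : 0 < e := norm_pos_iff.2 hne
  obtain ⟨R, hR, hRn⟩ := exists_eventually_norm_sum_le hclt (c := 1 / 2)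
    (by rw [ENNReal.div_lt_iff] <;> norm_num)
  have h1 := tendstoInMeasure_iff_norm.1 hmeas (e / 2) (by positivity)
  have h2 : ∀ᶠ n : ℕ in atTop, R * Real.sqrt n < n * (e / 2) := by
    have : Tendsto (fun n : ℕ => Real.sqrt n * (e / 2)) atTop atTop :=
      (Real.tendsto_sqrt_atTop.comp tendsto_natCast_atTop_atTop).atTop_mul_const (by positivity)
    filter_upwards [this.eventually_gt_atTop R, eventually_gt_atTop 0] with n hn hn0
    have hs : 0 < Real.sqrt n := Real.sqrt_pos.2 (by exact_mod_cast hn0)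
    calc R * Real.sqrt n < Real.sqrt n * (e / 2) * Real.sqrt n := by gcongr
      _ = n * (e / 2) := by
        rw [mul_right_comm, Real.mul_self_sqrt (Nat.cast_nonneg n)]
  obtain ⟨n, hn1, hn2, hn3, hn0⟩ := ((h1.eventually (gt_mem_nhds
    (by norm_num : (0 : ℝ≥0∞) < 1 / 2))).and
    (hRn.and (h2.and (eventually_gt_atTop 0)))).exists
  refine absurd (hn2.trans_le (measure_mono fun ω hω => ?_)) hn1.not_gt
  have hn0' : (0 : ℝ) < n := by exact_mod_cast hn0
  rw [mem_ofPred] at hω ⊢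
  have h3 : ‖(n : ℝ)⁻¹ • ∑ j ∈ Finset.range n, X j ω‖ ≤ e / 2 := by
    rw [norm_smul, norm_inv, Real.norm_of_nonneg hn0'.le, inv_mul_le_iff₀ hn0']
    linarith
  have h4 := norm_sub_norm_le (∫ ω, X 0 ω ∂P) ((n : ℝ)⁻¹ • ∑ j ∈ Finset.range n, X j ω)
  rw [norm_sub_rev]
  linarith

end Tails

/-! ### Centered Gaussian measures and dominating points -/

section Polarisation

variable {B : Type*} [NormedAddCommGroup B] [NormedSpace ℝ B] [MeasurableSpace B]

lemma integral_sq_smul_add {ν : Measure B} {L f : StrongDual ℝ B} (hL : MemLp L 2 ν)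
    (hf : MemLp f 2 ν) (t : ℝ) :
    ∫ x, (t • L + f) x ^ 2 ∂ν =
      t ^ 2 * ∫ x, L x ^ 2 ∂ν + 2 * t * ∫ x, f x * L x ∂ν + ∫ x, f x ^ 2 ∂ν := by
  have h1 : Integrable (fun x => t ^ 2 * L x ^ 2) ν := hL.integrable_sq.const_mul _
  have h2 : Integrable (fun x => 2 * t * (f x * L x)) ν := (hf.integrable_mul hL).const_mul _
  have h3 : Integrable (fun x => f x ^ 2) ν := hf.integrable_sq
  have h12 : Integrable (fun x => t ^ 2 * L x ^ 2 + 2 * t * (f x * L x)) ν := h1.add h2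
  rw [← integral_const_mul, ← integral_const_mul, ← integral_add h1 h2, ← integral_add h12 h3]
  refine integral_congr_ae (ae_of_all _ fun x => ?_)
  simp only [add_apply, smul_apply, smul_eq_mul]
  ring

/-- Polarisation: two laws with the same variances of all linear functionals have the same
covariances. -/
lemma integral_mul_eq_of_integral_sq_eq {ν ν' : Measure B}
    (hν : ∀ L : StrongDual ℝ B, MemLp L 2 ν) (hν' : ∀ L : StrongDual ℝ B, MemLp L 2 ν')
    (h : ∀ L : StrongDual ℝ B, ∫ x, L x ^ 2 ∂ν = ∫ x, L x ^ 2 ∂ν') (f L : StrongDual ℝ B) :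
    ∫ x, f x * L x ∂ν = ∫ x, f x * L x ∂ν' := by
  have h1 := integral_sq_smul_add (hν L) (hν f) 1
  have h2 := integral_sq_smul_add (hν' L) (hν' f) 1
  rw [h, h L, h f] at h1
  linarith

end Polarisation

section Gaussian

variable {B : Type*} [NormedAddCommGroup B] [NormedSpace ℝ B] [MeasurableSpace B] [BorelSpace B]
  {γ : Measure B} [IsGaussian γ]

lemma map_dual_eq (hγ : ∀ L : StrongDual ℝ B, ∫ x, L x ∂γ = 0) (L : StrongDual ℝ B) :
    γ.map L = gaussianReal 0 (∫ x, L x ^ 2 ∂γ).toNNReal := by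
  rw [IsGaussian.map_eq_gaussianReal, hγ, variance_of_integral_eq_zero (by fun_prop) (hγ L)]

lemma integrable_exp_dual (γ : Measure B) [IsGaussian γ] (L : StrongDual ℝ B) :
    Integrable (fun x => Real.exp (L x)) γ := by
  have h := integrable_exp_mul_gaussianReal (μ := γ[L]) (v := Var[L; γ].toNNReal) 1
  rw [← IsGaussian.map_eq_gaussianReal, integrable_map_measure (by fun_prop) (by fun_prop)] at h
  simpa [Function.comp_def] using h

/-- The Laplace transform of a centered Gaussian measure. -/
lemma integral_exp_dual (hγ : ∀ L : StrongDual ℝ B, ∫ x, L x ∂γ = 0) (L : StrongDual ℝ B) :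
    ∫ x, Real.exp (L x) ∂γ = Real.exp ((∫ x, L x ^ 2 ∂γ) / 2) := by
  have h := mgf_gaussianReal (map_dual_eq hγ L) 1
  simpa [mgf, Real.coe_toNNReal _ (integral_nonneg fun x => sq_nonneg (L x))] using h

lemma logLaplace_eq (hγ : ∀ L : StrongDual ℝ B, ∫ x, L x ∂γ = 0) (L : StrongDual ℝ B) :
    logLaplace γ L = (((∫ x, L x ^ 2 ∂γ) / 2 : ℝ) : EReal) := by
  rw [logLaplace, ← ofReal_integral_eq_lintegral_ofReal (integrable_exp_dual γ L)
    (ae_of_all _ fun _ => (Real.exp_pos _).le), integral_exp_dual hγ,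
    ENNReal.log_ofReal_of_pos (Real.exp_pos _), Real.log_exp]

section Banach

variable [CompleteSpace B] [SecondCountableTopology B]

lemma integrable_dual_smul (γ : Measure B) [IsGaussian γ] (f : StrongDual ℝ B) :
    Integrable (fun x => f x • x) γ :=
  memLp_one_iff_integrable.1 <|
    (IsGaussian.memLp_id γ 2 (by simp)).smul (IsGaussian.memLp_dual γ f 2 (by simp))

lemma dual_covVec (γ : Measure B) [IsGaussian γ] (f L : StrongDual ℝ B) :
    L (covVec γ f) = ∫ x, f x * L x ∂γ := by
  rw [covVec, ← L.integral_comp_comm (integrable_dual_smul γ f)]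
  simp

/-- **Cameron–Martin**: tilting a centered Gaussian measure by a continuous linear functional `f`
amounts to translating it by `covVec γ f`. -/
lemma tilted_eq_map_add_covVec (hγ : ∀ L : StrongDual ℝ B, ∫ x, L x ∂γ = 0)
    (f : StrongDual ℝ B) : γ.tilted f = γ.map (· + covVec γ f) := by
  have hf := integrable_exp_dual γ f
  have : IsProbabilityMeasure (γ.tilted f) := isProbabilityMeasure_tilted hf
  have : IsProbabilityMeasure (γ.map (· + covVec γ f)) :=
    Measure.isProbabilityMeasure_map (by fun_prop)
  refine Measure.ext_of_charFunDual (funext fun L => ?_)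
  rw [charFunDual_eq_charFun_map_one, charFunDual_eq_charFun_map_one]
  congr 1
  set v : NNReal := (∫ x, L x ^ 2 ∂γ).toNNReal with hv
  have hvr : (v : ℝ) = ∫ x, L x ^ 2 ∂γ :=
    Real.coe_toNNReal _ (integral_nonneg fun x => sq_nonneg (L x))
  have hright : (γ.map (· + covVec γ f)).map L = gaussianReal (L (covVec γ f)) v := by
    have h1 := gaussianReal_map_add_const (μ := 0) (v := v) (L (covVec γ f))
    rw [← map_dual_eq hγ L, Measure.map_map (by fun_prop) (by fun_prop), zero_add] at h1
    rw [← h1, Measure.map_map (by fun_prop) (by fun_prop)]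
    congr 1
    ext x
    simp
  rw [hright]
  -- the two laws have the same moment generating function, finite everywhere
  have hmgf : mgf L (γ.tilted f) = mgf id (gaussianReal (L (covVec γ f)) v) := by
    rw [mgf_id_gaussianReal]
    ext t
    have h1 : ∀ x, (⇑f + fun x => t * L x) x = (t • L + f) x := fun x => by
      simp [add_comm]
    rw [mgf, integral_exp_tilted f (fun x => t * L x)]
    simp_rw [h1]
    rw [integral_exp_dual hγ, integral_exp_dual hγ, integral_sq_smul_add
      (IsGaussian.memLp_dual γ L 2 (by simp)) (IsGaussian.memLp_dual γ f 2 (by simp)),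
      ← Real.exp_sub, dual_covVec, hvr]
    congr 1
    ring
  have hset : integrableExpSet L (γ.tilted f) = univ := by
    refine eq_univ_of_forall fun t => ?_
    rw [integrableExpSet, mem_ofPred, integrable_tilted_iff hf]
    refine (integrable_exp_dual γ (t • L + f)).congr (ae_of_all _ fun x => ?_)
    simp [← Real.exp_add, add_comm]
  have hc : complexMGF L (γ.tilted f) = complexMGF id (gaussianReal (L (covVec γ f)) v) := by
    have h2 := eqOn_complexMGF_of_mgf hmgf
    rw [hset, interior_univ] at h2
    exact funext fun z => h2 (mem_univ _)
  simpa using Measure.ext_of_complexMGF_eq (by fun_prop) (by fun_prop) hc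

/-- A centered Gaussian measure charges every ball around the origin: it charges some ball `U` of
radius `r`, and the difference of two independent points of `U` is small, while `(x - y) / √2` has
again the law `γ`. -/
lemma measure_ball_zero_pos (hγ : ∀ L : StrongDual ℝ B, ∫ x, L x ∂γ = 0) {r : ℝ} (hr : 0 < r) :
    0 < γ (Metric.ball 0 r) := by
  obtain ⟨y, hy⟩ : ∃ y : B, 0 < γ (Metric.ball y (r / 2)) := by
    by_contra! h
    have h0 : ∀ y : B, γ (Metric.ball y (r / 2)) = 0 := fun y => le_antisymm (h y) bot_le
    have h1 : γ (⋃ n, Metric.ball (TopologicalSpace.denseSeq B n) (r / 2)) = 0 :=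
      measure_iUnion_null fun n => h0 _
    have h2 : (⋃ n, Metric.ball (TopologicalSpace.denseSeq B n) (r / 2)) = univ := by
      refine eq_univ_of_forall fun x => mem_iUnion.2 ?_
      obtain ⟨n, hn⟩ := (TopologicalSpace.denseRange_denseSeq B).exists_dist_lt x
        (by positivity : 0 < r / 2)
      exact ⟨n, hn⟩
    rw [h2, measure_univ] at h1
    exact one_ne_zero h1
  have hrot := IsGaussian.map_rotation_eq_self_of_forall_strongDual_eq_zero hγ (-(Real.pi / 4))
  have hfst : γ (Metric.ball 0 r) = (γ.prod γ) (Prod.fst ⁻¹' Metric.ball 0 r) := by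
    rw [← Measure.map_apply measurable_fst Metric.isOpen_ball.measurableSet, Measure.map_fst_prod]
    simp
  rw [hfst, ← hrot, Measure.map_apply (by fun_prop)
    (measurable_fst Metric.isOpen_ball.measurableSet)]
  have hpos : 0 < (γ.prod γ) (Metric.ball y (r / 2) ×ˢ Metric.ball y (r / 2)) := by
    rw [Measure.prod_prod]
    exact ENNReal.mul_pos hy.ne' hy.ne'
  refine hpos.trans_le (measure_mono ?_)
  rintro ⟨x, z⟩ ⟨hx, hz⟩
  simp only [mem_preimage, ContinuousLinearMap.rotation_apply, Real.cos_neg, Real.sin_neg,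
    Real.cos_pi_div_four, Real.sin_pi_div_four, mem_ball_zero_iff]
  rw [Metric.mem_ball, dist_eq_norm] at hx hz
  have h1 : (Real.sqrt 2 / 2) • x + -(Real.sqrt 2 / 2) • z =
      (Real.sqrt 2 / 2) • ((x - y) - (z - y)) := by
    rw [neg_smul, ← sub_eq_add_neg, ← smul_sub]
    congr 1
    abel
  have h2 : Real.sqrt 2 / 2 ≤ 1 := by
    have : Real.sqrt 2 ≤ 2 := Real.sqrt_le_iff.2 (by norm_num)
    linarith
  rw [h1, norm_smul, Real.norm_of_nonneg (by positivity)]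
  calc Real.sqrt 2 / 2 * ‖(x - y) - (z - y)‖ ≤ 1 * ‖(x - y) - (z - y)‖ := by gcongr
    _ ≤ ‖x - y‖ + ‖z - y‖ := by rw [one_mul]; exact norm_sub_le _ _
    _ < r := by linarith

/-- A centered Gaussian measure charges the open sets that meet its generating Hilbert space. -/
lemma measure_pos_of_inter_generatingSpace (hγ : ∀ L : StrongDual ℝ B, ∫ x, L x ∂γ = 0)
    {U : Set B} (hU : IsOpen U) (hne : (U ∩ generatingSpace γ).Nonempty) : 0 < γ U := by
  obtain ⟨x, hxU, f, -, hf⟩ := hne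
  obtain ⟨k, hk⟩ := (hf.eventually (hU.mem_nhds hxU)).exists
  obtain ⟨r, hr, hball⟩ := Metric.isOpen_iff.1 hU _ hk
  have h1 : γ.tilted (f k) (Metric.ball (covVec γ (f k)) r) ≠ 0 := by
    rw [tilted_eq_map_add_covVec hγ, Measure.map_apply (by fun_prop)
      Metric.isOpen_ball.measurableSet]
    refine ((measure_ball_zero_pos hγ hr).trans_le (measure_mono fun z hz => ?_)).ne'
    simpa using hz
  refine pos_iff_ne_zero.2 fun h0 => h1 ?_
  exact tilted_absolutelyContinuous γ _ (measure_mono_null hball h0)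

/-- The point belonging to a dominating functional `g` is `covVec γ g`. -/
lemma IsDominatingFunctional.eq_covVec (hγ : ∀ L : StrongDual ℝ B, ∫ x, L x ∂γ = 0)
    {D : Set B} {a : B} {g : StrongDual ℝ B} (hg : IsDominatingFunctional γ D a g) :
    a = covVec γ g := by
  have h1 : ∫ x, x ∂(γ.tilted g) = a := by
    rw [integral_tilted, hg.eq_integral, logLaplace_eq hγ, integral_exp_dual hγ]
    simp [Real.exp_sub]
  rw [← h1, tilted_eq_map_add_covVec hγ, integral_map (by fun_prop) (by fun_prop),
    integral_add IsGaussian.integrable_fun_id (by simp)]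
  have h2 : ∫ x, x ∂γ = 0 := by
    refine (SeparatingDual.eq_zero_iff_forall_dual_eq_zero (R := ℝ) _).2 fun L => ?_
    rw [← IsGaussian.integral_dual]
    exact hγ L
  simp [h2]

lemma IsDominatingFunctional.rate_eq_half (hγ : ∀ L : StrongDual ℝ B, ∫ x, L x ∂γ = 0)
    {D : Set B} {a : B} {g : StrongDual ℝ B} (hg : IsDominatingFunctional γ D a g) :
    rate γ a = (((∫ x, g x ^ 2 ∂γ) / 2 : ℝ) : EReal) := by
  have h1 : g a = ∫ x, g x ^ 2 ∂γ := by
    conv_lhs => rw [hg.eq_covVec hγ]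
    rw [dual_covVec]
    simp [sq]
  rw [hg.rate_eq, logLaplace_eq hγ, h1, ← EReal.coe_sub]
  congr 1
  ring

end Banach

end Gaussian

/-! ### Marginals of the limit law and exponential moments -/

section Limit

variable {B : Type*} [NormedAddCommGroup B] [NormedSpace ℝ B] [MeasurableSpace B] [BorelSpace B]

lemma zero_mem_interior_integrableExpSet {Ω : Type*} [MeasurableSpace Ω] {P : Measure Ω}
    [IsProbabilityMeasure P] {ξ : Ω → ℝ} (hξ : Measurable ξ)
    (hexp : ∃ tf : ℝ, 0 < tf ∧ ∀ t : ℝ, 0 < |t| → |t| < tf →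
      Integrable (fun ω => Real.exp (t * |ξ ω|)) P) :
    0 ∈ interior (integrableExpSet ξ P) := by
  obtain ⟨T, hT, h⟩ := hexp
  refine mem_interior.2 ⟨Metric.ball 0 T, fun t ht => ?_, Metric.isOpen_ball, by simpa using hT⟩
  rw [mem_ball_zero_iff, Real.norm_eq_abs] at ht
  rw [integrableExpSet, mem_ofPred]
  rcases eq_or_ne t 0 with rfl | h0
  · simp
  · refine (h |t| (by simpa using h0) (by simpa using ht)).mono' (by fun_prop)
      (ae_of_all _ fun ω => ?_)
    rw [Real.norm_of_nonneg (Real.exp_pos _).le, ← abs_mul]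
    exact Real.exp_le_exp.2 (le_abs_self _)

variable [CompleteSpace B] [SecondCountableTopology B]
  {Ω : Type*} [MeasurableSpace Ω] {P : Measure Ω} [IsProbabilityMeasure P] {X : ℕ → Ω → B}
  {γ : Measure B} [IsProbabilityMeasure γ]

/-- The one-dimensional marginals of the limit law are identified by the scalar central limit
theorem. -/
lemma map_dual_eq_of_clt (hX : ∀ j, Measurable (X j)) (hindep : iIndepFun X P)
    (hident : ∀ j, IdentDistrib (X j) (X 0) P P)
    (hclt : TendstoInDistribution
      (fun (n : ℕ) (ω : Ω) => (Real.sqrt n)⁻¹ • ∑ j ∈ Finset.range n, X j ω)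
      atTop (id : B → B) (fun _ => P) γ)
    (L : StrongDual ℝ B) (hL : MemLp (fun ω => L (X 0 ω)) 2 P) :
    γ.map L = gaussianReal 0 (∫ ω, L (X 0 ω) ^ 2 ∂P).toNNReal := by
  have hint : Integrable (X 0) P :=
    (memLp_three_halves hX hindep hident hclt).integrable (by
      rw [ENNReal.le_div_iff_mul_le] <;> norm_num)
  have hmean : ∫ ω, L (X 0 ω) ∂P = 0 := by
    rw [L.integral_comp_comm hint, integral_eq_zero_of_clt hX hindep hident hclt, map_zero]
  have hvar : Var[fun ω => L (X 0 ω); P] = ∫ ω, L (X 0 ω) ^ 2 ∂P :=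
    variance_of_integral_eq_zero (L.continuous.measurable.comp (hX 0)).aemeasurable hmean
  have h1 := tendstoInDistribution_inv_sqrt_mul_sum_sub (P := P)
    (P' := gaussianReal 0 (∫ ω, L (X 0 ω) ^ 2 ∂P).toNNReal) (Y := id)
    (X := fun j ω => L (X j ω)) (by rw [hvar]; exact HasLaw.id) hL
    (hindep.comp (fun _ x => L x) (fun _ => by fun_prop))
    (fun j => (hident j).comp (u := fun x => L x) (by fun_prop))
  have h2 := hclt.continuous_comp L.continuous
  have h3 := tendstoInDistribution_unique _ h1 (Z := id) (W := (L : B → ℝ) ∘ id)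
    (by
      convert! h2 using 1
      funext n ω
      simp [hmean])
  simpa using h3.symm

end Limit

section Moments

variable {Ω : Type*} [MeasurableSpace Ω] {μ : Measure Ω} {ξ : Ω → ℝ}

lemma exists_integrable_exp_abs (hξ : 0 ∈ interior (integrableExpSet ξ μ)) :
    ∃ r : ℝ, 0 < r ∧ ∀ s : ℝ, |s| ≤ r → Integrable (fun ω => Real.exp (s * |ξ ω|)) μ := by
  obtain ⟨T, hT, h⟩ := Metric.isOpen_iff.1 isOpen_interior 0 hξ
  refine ⟨T / 2, by positivity, fun s hs => ?_⟩
  have hmem : ∀ u : ℝ, |u| ≤ T / 2 → u ∈ integrableExpSet ξ μ := fun u hu =>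
    interior_subset (h (by rw [mem_ball_zero_iff, Real.norm_eq_abs]; linarith))
  exact integrable_exp_mul_abs (hmem s hs) (hmem (-s) (by rwa [abs_neg]))

lemma one_le_mgf [IsProbabilityMeasure μ] (hξ : 0 ∈ interior (integrableExpSet ξ μ))
    (h0 : ∫ ω, ξ ω ∂μ = 0) {s : ℝ} (hs : Integrable (fun ω => Real.exp (s * ξ ω)) μ) :
    1 ≤ mgf ξ μ s := by
  have hint : Integrable ξ μ := integrable_of_mem_interior_integrableExpSet hξ
  calc (1 : ℝ) = ∫ ω, (s * ξ ω + 1) ∂μ := by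
        rw [integral_add (hint.const_mul s) (by simp), integral_const_mul, h0]
        simp
    _ ≤ mgf ξ μ s := integral_mono ((hint.const_mul s).add (by simp)) hs
        fun ω => Real.add_one_le_exp _

/-- Integration of a power bound for the derivative. -/
lemma isBigO_pow_succ_of_deriv {F F' : ℝ → ℝ} {k : ℕ} (h0 : F 0 = 0)
    (hF : ∀ᶠ s in 𝓝 0, HasDerivAt F (F' s) s) (hO : F' =O[𝓝 0] fun s => s ^ k) :
    F =O[𝓝 0] fun s => s ^ (k + 1) := by
  obtain ⟨C, hC⟩ := hO.bound
  obtain ⟨e, he, hball⟩ := Metric.eventually_nhds_iff_ball.1 (hF.and hC)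
  refine Asymptotics.IsBigO.of_bound C (Metric.eventually_nhds_iff_ball.2 ⟨e, he, fun s hs => ?_⟩)
  have hsub : ∀ x ∈ Metric.closedBall (0 : ℝ) ‖s‖, x ∈ Metric.ball (0 : ℝ) e := by
    intro x hx
    rw [mem_closedBall_zero_iff] at hx
    rw [mem_ball_zero_iff] at hs ⊢
    exact hx.trans_lt hs
  have hC0 : ∀ x ∈ Metric.closedBall (0 : ℝ) ‖s‖, ‖F' x‖ ≤ |C| * ‖s‖ ^ k := by
    intro x hx
    refine ((hball x (hsub x hx)).2).trans ?_
    rw [mem_closedBall_zero_iff] at hx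
    rw [norm_pow]
    gcongr
    exact le_abs_self C
  have h1 := (convex_closedBall (0 : ℝ) ‖s‖).norm_image_sub_le_of_norm_hasDerivWithin_le
    (fun x hx => (hball x (hsub x hx)).1.hasDerivWithinAt) hC0 (x := 0) (y := s)
    (by simp) (by simp)
  rw [h0, sub_zero, sub_zero] at h1
  rw [norm_pow, pow_succ]
  have hs2 : 0 ≤ C ∨ s = 0 := by
    by_contra! hcon
    have h2 := (hball s hs).2
    have h3 : 0 < ‖s ^ k‖ := by
      rw [norm_pow]
      exact pow_pos (norm_pos_iff.2 hcon.2) k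
    nlinarith [norm_nonneg (F' s)]
  rcases hs2 with h | h
  · rw [abs_of_nonneg h] at h1
    linarith
  · simp [h, h0]

end Moments

/-! ### Expansions of the cumulant generating function and characteristic functions -/

section Cumulants

variable {Ω : Type*} [MeasurableSpace Ω] {μ : Measure Ω} {ξ : Ω → ℝ}

lemma hasDerivAt_cgf {s : ℝ} (hs : s ∈ interior (integrableExpSet ξ μ)) :
    HasDerivAt (cgf ξ μ) (deriv (cgf ξ μ) s) s :=
  (analyticAt_cgf hs).differentiableAt.hasDerivAt

lemma hasDerivAt_deriv_cgf {s : ℝ} (hs : s ∈ interior (integrableExpSet ξ μ)) :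
    HasDerivAt (deriv (cgf ξ μ)) (iteratedDeriv 2 (cgf ξ μ) s) s := by
  rw [iteratedDeriv_succ, iteratedDeriv_one]
  exact (analyticAt_cgf hs).deriv.differentiableAt.hasDerivAt

variable [IsProbabilityMeasure μ]

lemma iteratedDeriv_two_cgf_zero (hξ : 0 ∈ interior (integrableExpSet ξ μ))
    (h0 : ∫ ω, ξ ω ∂μ = 0) : iteratedDeriv 2 (cgf ξ μ) 0 = ∫ ω, ξ ω ^ 2 ∂μ := by
  rw [iteratedDeriv_two_cgf hξ, deriv_cgf_zero hξ, h0]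
  simp

lemma iteratedDeriv_two_cgf_sub_isBigO (hξ : 0 ∈ interior (integrableExpSet ξ μ))
    (h0 : ∫ ω, ξ ω ∂μ = 0) :
    (fun s => iteratedDeriv 2 (cgf ξ μ) s - ∫ ω, ξ ω ^ 2 ∂μ) =O[𝓝 0] fun s => s ^ 1 := by
  have h1 : DifferentiableAt ℝ (iteratedDeriv 2 (cgf ξ μ)) 0 := by
    rw [iteratedDeriv_succ, iteratedDeriv_one]
    exact (analyticAt_cgf hξ).deriv.deriv.differentiableAt
  simpa [iteratedDeriv_two_cgf_zero hξ h0] using h1.isBigO_sub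

lemma deriv_cgf_sub_isBigO (hξ : 0 ∈ interior (integrableExpSet ξ μ))
    (h0 : ∫ ω, ξ ω ∂μ = 0) :
    (fun s => deriv (cgf ξ μ) s - s * ∫ ω, ξ ω ^ 2 ∂μ) =O[𝓝 0] fun s => s ^ 2 := by
  refine isBigO_pow_succ_of_deriv (F' := fun s => iteratedDeriv 2 (cgf ξ μ) s - ∫ ω, ξ ω ^ 2 ∂μ)
    ?_ ?_ (iteratedDeriv_two_cgf_sub_isBigO hξ h0)
  · simp [deriv_cgf_zero hξ, h0]
  · filter_upwards [isOpen_interior.mem_nhds hξ] with s hs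
    convert! (hasDerivAt_deriv_cgf hs).sub
      ((hasDerivAt_id s).mul_const (∫ ω, ξ ω ^ 2 ∂μ)) using 1
    simp

/-- Third-order expansion of the Legendre-type combination of the cumulant generating function
which is the exponent left over by the exponential change of measure. -/
lemma cgf_sub_mul_deriv_isBigO (hξ : 0 ∈ interior (integrableExpSet ξ μ))
    (h0 : ∫ ω, ξ ω ∂μ = 0) :
    (fun s => cgf ξ μ s - s * deriv (cgf ξ μ) s + s ^ 2 * (∫ ω, ξ ω ^ 2 ∂μ) / 2)
      =O[𝓝 0] fun s => s ^ 3 := by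
  set v := ∫ ω, ξ ω ^ 2 ∂μ with hv
  refine isBigO_pow_succ_of_deriv (F' := fun s => -(s * (iteratedDeriv 2 (cgf ξ μ) s - v)))
    ?_ ?_ ?_
  · simp
  · filter_upwards [isOpen_interior.mem_nhds hξ] with s hs
    have h1 := ((hasDerivAt_cgf hs).sub ((hasDerivAt_id s).mul (hasDerivAt_deriv_cgf hs))).add
      (((hasDerivAt_pow 2 s).mul_const v).div_const 2)
    convert! h1 using 1
    simp
    ring
  · have h2 := (Asymptotics.isBigO_refl (fun s : ℝ => s) (𝓝 0)).mul
      (iteratedDeriv_two_cgf_sub_isBigO hξ h0)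
    refine h2.neg_left.congr_right fun s => by ring

lemma pow_three_le_exp {x : ℝ} (hx : 0 ≤ x) : x ^ 3 ≤ 6 * Real.exp x := by
  have := Real.pow_div_factorial_le_exp x hx 3
  norm_num [Nat.factorial] at this
  linarith

/-- Quadratic approximation of the characteristic function of a centered law, with an error that
only involves an absolute exponential moment. -/
lemma norm_charFun_sub_le {ζ : Ω → ℝ} (hζm : AEMeasurable ζ μ) (hζ0 : ∫ ω, ζ ω ∂μ = 0) {c t : ℝ}
    (hc : 0 < c) (ht : |t| ≤ c)
    (hint : Integrable (fun ω => Real.exp (2 * c * |ζ ω|)) μ) :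
    ‖(∫ ω, Complex.exp (t * ζ ω * Complex.I) ∂μ) -
        ((1 - t ^ 2 * (∫ ω, ζ ω ^ 2 ∂μ) / 2 : ℝ) : ℂ)‖ ≤
      |t| ^ 3 * (6 / c ^ 3 * ∫ ω, Real.exp (2 * c * |ζ ω|) ∂μ) := by
  have hmem : 0 ∈ interior (integrableExpSet ζ μ) := by
    refine mem_interior.2 ⟨Metric.ball 0 (2 * c), fun u hu => ?_, Metric.isOpen_ball, by simpa⟩
    rw [mem_ball_zero_iff, Real.norm_eq_abs] at hu
    refine hint.mono' (by fun_prop) (ae_of_all _ fun ω => ?_)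
    rw [Real.norm_of_nonneg (Real.exp_pos _).le]
    refine Real.exp_le_exp.2 ((le_abs_self _).trans ?_)
    rw [abs_mul]
    gcongr
  have hi1 : Integrable ζ μ := integrable_of_mem_interior_integrableExpSet hmem
  have hi2 : Integrable (fun ω => ζ ω ^ 2) μ :=
    (memLp_of_mem_interior_integrableExpSet hmem 2).integrable_sq
  have hexpi : Integrable (fun ω => Complex.exp (t * ζ ω * Complex.I)) μ := by
    refine Integrable.mono' (integrable_const (1 : ℝ)) (by fun_prop) (ae_of_all _ fun ω => ?_)
    rw [← Complex.ofReal_mul, Complex.norm_exp_ofReal_mul_I]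
  have hi1' : Integrable (fun ω => (t * Complex.I) * (ζ ω : ℂ)) μ := hi1.ofReal.const_mul _
  have hi2' : Integrable (fun ω => (-(t ^ 2 / 2) : ℂ) * ((ζ ω ^ 2 : ℝ) : ℂ)) μ :=
    hi2.ofReal.const_mul _
  have hpoly : (((1 - t ^ 2 * (∫ ω, ζ ω ^ 2 ∂μ) / 2 : ℝ)) : ℂ) =
      ∫ ω, (1 + (t * Complex.I) * (ζ ω : ℂ) + (-(t ^ 2 / 2) : ℂ) * ((ζ ω ^ 2 : ℝ) : ℂ)) ∂μ := by
    have h1 : Integrable (fun ω => 1 + (t * Complex.I) * (ζ ω : ℂ)) μ :=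
      (integrable_const (1 : ℂ)).add hi1'
    rw [integral_add h1 hi2',
      integral_add (integrable_const (1 : ℂ)) hi1', integral_const_mul, integral_const_mul,
      integral_complex_ofReal, integral_complex_ofReal, hζ0]
    simp
    ring
  have hipoly : Integrable (fun ω => 1 + (t * Complex.I) * (ζ ω : ℂ) +
      (-(t ^ 2 / 2) : ℂ) * ((ζ ω ^ 2 : ℝ) : ℂ)) μ := ((integrable_const (1 : ℂ)).add hi1').add hi2'
  rw [hpoly, ← integral_sub hexpi hipoly]
  calc ‖∫ ω, (Complex.exp (t * ζ ω * Complex.I) - (1 + (t * Complex.I) * (ζ ω : ℂ) +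
          (-(t ^ 2 / 2) : ℂ) * ((ζ ω ^ 2 : ℝ) : ℂ))) ∂μ‖
      ≤ ∫ ω, |t| ^ 3 * (6 / c ^ 3) * Real.exp (2 * c * |ζ ω|) ∂μ := by
        refine norm_integral_le_of_norm_le (hint.const_mul _) (ae_of_all _ fun ω => ?_)
        have h1 := Complex.norm_exp_sub_sum_le_norm_mul_exp (t * ζ ω * Complex.I) 3
        have h2 : ‖(t * ζ ω * Complex.I : ℂ)‖ = |t| * |ζ ω| := by simp
        have h3 : ∑ m ∈ Finset.range 3, (t * ζ ω * Complex.I : ℂ) ^ m / (m.factorial : ℂ) =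
            1 + (t * Complex.I) * (ζ ω : ℂ) + (-(t ^ 2 / 2) : ℂ) * ((ζ ω ^ 2 : ℝ) : ℂ) := by
          simp only [Finset.sum_range_succ, Finset.sum_range_zero]
          push_cast
          simp only [mul_pow, Complex.I_sq]
          norm_num [Nat.factorial]
          ring
        rw [h2, h3] at h1
        refine h1.trans ?_
        have h4 := pow_three_le_exp (mul_nonneg hc.le (abs_nonneg (ζ ω)))
        have h5 : |ζ ω| ^ 3 ≤ 6 / c ^ 3 * Real.exp (c * |ζ ω|) := by
          rw [div_mul_eq_mul_div, le_div_iff₀ (by positivity)]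
          calc |ζ ω| ^ 3 * c ^ 3 = (c * |ζ ω|) ^ 3 := by ring
            _ ≤ _ := h4
        calc (|t| * |ζ ω|) ^ 3 * Real.exp (|t| * |ζ ω|)
            = |t| ^ 3 * (|ζ ω| ^ 3 * Real.exp (|t| * |ζ ω|)) := by ring
          _ ≤ |t| ^ 3 * ((6 / c ^ 3 * Real.exp (c * |ζ ω|)) * Real.exp (c * |ζ ω|)) := by gcongr
          _ = |t| ^ 3 * (6 / c ^ 3) * Real.exp (2 * c * |ζ ω|) := by
            rw [show 2 * c * |ζ ω| = c * |ζ ω| + c * |ζ ω| by ring, Real.exp_add]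
            ring
    _ = _ := by rw [integral_const_mul]; ring

/-- Gaussian domination, uniform in the tilting parameter `s`, of the characteristic functions of
the tilted laws on a neighbourhood of the origin. -/
lemma exists_norm_charFun_tilted_le (hξ : 0 ∈ interior (integrableExpSet ξ μ))
    (h0 : ∫ ω, ξ ω ∂μ = 0) (hv : 0 < ∫ ω, ξ ω ^ 2 ∂μ) {η : ℝ} (hη : 0 < η) :
    ∃ c : ℝ, 0 < c ∧ ∀ᶠ s in 𝓝 (0 : ℝ), ∀ t : ℝ, |t| ≤ c →
      ‖charFun ((μ.tilted (fun ω => s * ξ ω)).map ξ) t‖ ≤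
        Real.exp (-((1 - η) * (∫ ω, ξ ω ^ 2 ∂μ) * t ^ 2 / 2)) := by
  set v := ∫ ω, ξ ω ^ 2 ∂μ with hvdef
  obtain ⟨r, hr, hrint⟩ := exists_integrable_exp_abs hξ
  -- half of the available exponential moment pays for the tilting, half for the Taylor remainder
  set c₀ := r / 4 with hc₀
  have hc₀pos : 0 < c₀ := by positivity
  set C := 6 / c₀ ^ 3 * (Real.exp (2 * c₀) * ∫ ω, Real.exp (r * |ξ ω|) ∂μ) with hC
  have hCpos : 0 ≤ C := by
    have : 0 ≤ ∫ ω, Real.exp (r * |ξ ω|) ∂μ := integral_nonneg fun _ => (Real.exp_pos _).le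
    positivity
  have hcont : Tendsto (iteratedDeriv 2 (cgf ξ μ)) (𝓝 0) (𝓝 v) := by
    have h1 := iteratedDeriv_two_cgf_sub_isBigO hξ h0
    have h2 := h1.trans_tendsto (by
      simp only [pow_one]
      exact tendsto_id)
    simpa [← hvdef] using h2.add_const v
  have hcontd : Tendsto (deriv (cgf ξ μ)) (𝓝 0) (𝓝 0) := by
    have h1 := (analyticAt_cgf hξ).deriv.continuousAt.tendsto
    rwa [deriv_cgf_zero hξ, h0, zero_div] at h1
  set c := min c₀ (min (1 / (v + 1)) (η * v / (4 * (C + 1)))) with hcdef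
  have hcpos : 0 < c := by
    refine lt_min hc₀pos (lt_min (by positivity) (by positivity))
  refine ⟨c, hcpos, ?_⟩
  filter_upwards [isOpen_interior.mem_nhds hξ, Metric.ball_mem_nhds (0 : ℝ) (half_pos hr),
    hcont.eventually (lt_mem_nhds (show v * (1 - η / 2) < v by nlinarith)),
    hcont.eventually (gt_mem_nhds (show v < v + 1 by linarith)),
    hcontd.eventually (Metric.ball_mem_nhds (0 : ℝ) one_pos)] with s hs hsr hV1 hV2 hm t ht
  rw [mem_ball_zero_iff, Real.norm_eq_abs] at hsr
  rw [dist_zero_right, Real.norm_eq_abs] at hm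
  have hsint : Integrable (fun ω => Real.exp (s * ξ ω)) μ :=
    interior_subset (s := integrableExpSet ξ μ) hs
  set ν := μ.tilted (fun ω => s * ξ ω) with hν
  have hprob : IsProbabilityMeasure ν := isProbabilityMeasure_tilted hsint
  have hξm : AEMeasurable ξ μ := aemeasurable_of_mem_interior_integrableExpSet hξ
  have hξm' : AEMeasurable ξ ν := hξm.mono_ac (tilted_absolutelyContinuous _ _)
  set m := deriv (cgf ξ μ) s with hmdef
  have hmean : ∫ ω, ξ ω ∂ν = m := integral_tilted_mul_self hs
  have hvar : ∫ ω, (ξ ω - m) ^ 2 ∂ν = iteratedDeriv 2 (cgf ξ μ) s := by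
    rw [← variance_tilted_mul hs, variance_eq_integral hξm', hmean]
  have hξint : Integrable ξ ν :=
    memLp_one_iff_integrable.1 (by exact_mod_cast memLp_tilted_mul hs 1)
  have hdom : ∀ ω, Real.exp (s * ξ ω) * Real.exp (2 * c₀ * |ξ ω - m|) ≤
      Real.exp (2 * c₀) * Real.exp (r * |ξ ω|) := by
    intro ω
    rw [← Real.exp_add, ← Real.exp_add]
    refine Real.exp_le_exp.2 ?_
    have h1 : s * ξ ω ≤ r / 2 * |ξ ω| := by
      refine (le_abs_self _).trans ?_
      rw [abs_mul]
      gcongr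
    have h2 : |ξ ω - m| ≤ |ξ ω| + 1 := by
      have := abs_sub (ξ ω) m
      linarith
    have h3 : 2 * c₀ * |ξ ω - m| ≤ 2 * c₀ * (|ξ ω| + 1) := by gcongr
    have h4 : 2 * c₀ = r / 2 := by rw [hc₀]; ring
    rw [h4] at h3 ⊢
    linarith
  have hrint' := hrint r (by rw [abs_of_pos hr])
  have hintμ : Integrable (fun ω => Real.exp (s * ξ ω) • Real.exp (2 * c₀ * |ξ ω - m|)) μ := by
    refine (hrint'.const_mul (Real.exp (2 * c₀))).mono' (by fun_prop) (ae_of_all _ fun ω => ?_)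
    rw [smul_eq_mul, Real.norm_of_nonneg (by positivity)]
    exact hdom ω
  have hintν : Integrable (fun ω => Real.exp (2 * c₀ * |ξ ω - m|)) ν :=
    (integrable_tilted_iff hsint _).2 hintμ
  have hbound : ∫ ω, Real.exp (2 * c₀ * |ξ ω - m|) ∂ν ≤
      Real.exp (2 * c₀) * ∫ ω, Real.exp (r * |ξ ω|) ∂μ := by
    rw [hν, integral_tilted_mul_eq_mgf, ← integral_const_mul]
    refine integral_mono_of_nonneg (ae_of_all _ fun ω => ?_) (hrint'.const_mul _)
      (ae_of_all _ fun ω => ?_)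
    · have := mgf_nonneg (X := ξ) (μ := μ) (t := s)
      positivity
    · refine le_trans ?_ (hdom ω)
      simp only [smul_eq_mul]
      gcongr
      exact div_le_self (Real.exp_pos _).le (one_le_mgf hξ h0 hsint)
  have hkey := norm_charFun_sub_le (μ := ν) (ζ := fun ω => ξ ω - m) (by fun_prop)
    (by rw [integral_sub hξint (by simp), hmean]; simp) hc₀pos
    (ht.trans (min_le_left _ _)) hintν
  rw [hvar] at hkey
  -- centering does not change the modulus of the characteristic function
  have hchar : ‖charFun (ν.map ξ) t‖ =
      ‖∫ ω, Complex.exp (t * ((ξ ω - m : ℝ) : ℂ) * Complex.I) ∂ν‖ := by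
    rw [charFun_apply_real, integral_map hξm' (by fun_prop)]
    have h1 : ∀ ω, Complex.exp (t * ((ξ ω - m : ℝ) : ℂ) * Complex.I) =
        Complex.exp (((-(t * m) : ℝ) : ℂ) * Complex.I) * Complex.exp (t * ξ ω * Complex.I) := by
      intro ω
      rw [← Complex.exp_add]
      congr 1
      push_cast
      ring
    simp_rw [h1]
    rw [integral_const_mul, norm_mul, Complex.norm_exp_ofReal_mul_I, one_mul]
  rw [hchar]
  set V := iteratedDeriv 2 (cgf ξ μ) s with hVdef
  have ht1 : |t| ≤ 1 / (v + 1) := ht.trans ((min_le_right _ _).trans (min_le_left _ _))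
  have ht2 : |t| ≤ η * v / (4 * (C + 1)) := ht.trans ((min_le_right _ _).trans (min_le_right _ _))
  have hpos : 0 ≤ 1 - t ^ 2 * V / 2 := by
    have h1 : t ^ 2 ≤ (1 / (v + 1)) ^ 2 := by rw [← sq_abs]; gcongr
    have h2 : t ^ 2 * V ≤ (1 / (v + 1)) ^ 2 * (v + 1) := by
      calc t ^ 2 * V ≤ t ^ 2 * (v + 1) := by gcongr
        _ ≤ _ := by gcongr
    have h3 : (1 / (v + 1)) ^ 2 * (v + 1) ≤ 1 := by
      have : (1 / (v + 1)) ^ 2 * (v + 1) = 1 / (v + 1) := by field_simp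
      rw [this, div_le_one (by positivity)]
      linarith
    linarith
  have hrem : |t| ^ 3 * (6 / c₀ ^ 3 * ∫ ω, Real.exp (2 * c₀ * |ξ ω - m|) ∂ν) ≤
      t ^ 2 * (η * v / 4) := by
    calc |t| ^ 3 * (6 / c₀ ^ 3 * ∫ ω, Real.exp (2 * c₀ * |ξ ω - m|) ∂ν)
        ≤ |t| ^ 3 * C := by rw [hC]; gcongr
      _ = t ^ 2 * (|t| * C) := by rw [pow_succ, sq_abs]; ring
      _ ≤ t ^ 2 * (η * v / (4 * (C + 1)) * (C + 1)) := by gcongr; linarith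
      _ = _ := by field_simp
  calc ‖∫ ω, Complex.exp (t * ((ξ ω - m : ℝ) : ℂ) * Complex.I) ∂ν‖
      ≤ ‖((1 - t ^ 2 * V / 2 : ℝ) : ℂ)‖ +
        ‖(∫ ω, Complex.exp (t * ((ξ ω - m : ℝ) : ℂ) * Complex.I) ∂ν) -
          ((1 - t ^ 2 * V / 2 : ℝ) : ℂ)‖ := norm_le_norm_add_norm_sub' _ _
    _ ≤ (1 - t ^ 2 * V / 2) + t ^ 2 * (η * v / 4) := by
        rw [Complex.norm_real, Real.norm_of_nonneg hpos]
        gcongr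
        exact hkey.trans hrem
    _ ≤ -((1 - η) * v * t ^ 2 / 2) + 1 := by
        nlinarith [mul_nonneg (sq_nonneg t) (sub_nonneg.2 hV1.le)]
    _ ≤ _ := Real.add_one_le_exp _

end Cumulants

/-! ### The tilted law -/

section TiltedMean

variable {B : Type*} [NormedAddCommGroup B] [NormedSpace ℝ B] [MeasurableSpace B]
  {μ : Measure B} {g : StrongDual ℝ B}

lemma tiltedLaw_eq (μ : Measure B) (g : StrongDual ℝ B) (s : ℝ) :
    tiltedLaw μ g s = μ.tilted (fun x => s * g x) := by
  simp [tiltedLaw]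

variable [BorelSpace B]

/-- Hölder's inequality with exponents `3` and `3 / 2`. -/
lemma exists_integrable_exp_mul_norm (hg : 0 ∈ interior (integrableExpSet g μ))
    (hLp : MemLp (fun x : B => x) (3 / 2) μ) :
    ∃ r : ℝ, 0 < r ∧ (∀ s : ℝ, |s| ≤ r → Integrable (fun x => Real.exp (s * g x)) μ) ∧
      Integrable (fun x => Real.exp (r * |g x|) * ‖x‖) μ := by
  obtain ⟨r, hr, h⟩ := exists_integrable_exp_abs hg
  refine ⟨r / 3, by positivity, fun s hs => ?_, ?_⟩
  · refine (h |s| (by rw [abs_abs]; linarith)).mono' (by fun_prop) (ae_of_all _ fun x => ?_)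
    rw [Real.norm_of_nonneg (Real.exp_pos _).le, ← abs_mul]
    exact Real.exp_le_exp.2 (le_abs_self _)
  · have h3 : MemLp (fun x => Real.exp (r / 3 * |g x|)) 3 μ := by
      rw [← integrable_norm_rpow_iff (by fun_prop) (by simp) (by simp)]
      refine (h r (by rw [abs_of_pos hr])).congr (ae_of_all _ fun x => ?_)
      simp only [Real.norm_of_nonneg (Real.exp_pos _).le, ENNReal.toReal_ofNat]
      rw [← Real.exp_mul]
      congr 1
      ring
    have : ENNReal.HolderTriple 3 (3 / 2) 1 := ⟨by
      rw [ENNReal.inv_div (by simp) (by simp), inv_one, ← one_div, ENNReal.div_add_div_same,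
        show (1 : ℝ≥0∞) + 2 = 3 by norm_num]
      exact ENNReal.div_self (by simp) (by simp)⟩
    exact h3.integrable_mul hLp.norm

lemma abs_exp_sub_one_sub_le (y : ℝ) : |Real.exp y - 1 - y| ≤ y ^ 2 * Real.exp |y| := by
  have h := Complex.norm_exp_sub_sum_le_norm_mul_exp (y : ℂ) 2
  simp only [Finset.sum_range_succ, Finset.sum_range_zero] at h
  norm_num at h
  rw [← Complex.ofReal_exp, ← Complex.ofReal_one, ← Complex.ofReal_add, ← Complex.ofReal_sub,
    Complex.norm_real, Real.norm_eq_abs] at h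
  rwa [sub_sub]

variable [SecondCountableTopology B]

lemma eventually_integrable_exp_smul (hg : 0 ∈ interior (integrableExpSet g μ))
    (hLp : MemLp (fun x : B => x) (3 / 2) μ) :
    ∀ᶠ s in 𝓝 (0 : ℝ), Integrable (fun x => Real.exp (s * g x) • x) μ := by
  obtain ⟨r, hr, -, hint⟩ := exists_integrable_exp_mul_norm hg hLp
  filter_upwards [Metric.ball_mem_nhds (0 : ℝ) hr] with s hs
  rw [mem_ball_zero_iff, Real.norm_eq_abs] at hs
  have hm : AEStronglyMeasurable (fun x => Real.exp (s * g x) • x) μ := by fun_prop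
  refine hint.mono' hm (ae_of_all _ fun x => ?_)
  rw [norm_smul, Real.norm_of_nonneg (Real.exp_pos _).le]
  refine mul_le_mul_of_nonneg_right (Real.exp_le_exp.2 ((le_abs_self _).trans ?_)) (norm_nonneg _)
  rw [abs_mul]
  gcongr

lemma eventually_integrable_tiltedLaw (hg : 0 ∈ interior (integrableExpSet g μ))
    (hLp : MemLp (fun x : B => x) (3 / 2) μ) :
    ∀ᶠ s in 𝓝 (0 : ℝ), Integrable (fun x : B => x) (tiltedLaw μ g s) := by
  filter_upwards [eventually_integrable_exp_smul hg hLp, isOpen_interior.mem_nhds hg] with s h hs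
  rw [tiltedLaw_eq]
  exact (integrable_tilted_iff (interior_subset (s := integrableExpSet g μ) hs) _).2 h

lemma integrable_apply_smul (hg : 0 ∈ interior (integrableExpSet g μ))
    (hLp : MemLp (fun x : B => x) (3 / 2) μ) : Integrable (fun x => g x • x) μ := by
  obtain ⟨r, hr, -, hint⟩ := exists_integrable_exp_mul_norm hg hLp
  have hm : AEStronglyMeasurable (fun x => g x • x) μ := by fun_prop
  refine (hint.const_mul (1 / r)).mono' hm (ae_of_all _ fun x => ?_)
  rw [norm_smul, Real.norm_eq_abs, ← mul_assoc]
  gcongr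
  rw [one_div, inv_mul_eq_div, le_div_iff₀ hr]
  have := Real.add_one_le_exp (r * |g x|)
  linarith

/-- First-order expansion, in the norm of `B`, of the mean of the tilted law. -/
lemma integral_tiltedLaw_sub_isBigO [CompleteSpace B] [IsProbabilityMeasure μ]
    (hg : 0 ∈ interior (integrableExpSet g μ))
    (hLp : MemLp (fun x : B => x) (3 / 2) μ) (h0 : ∫ x, x ∂μ = 0) :
    (fun s : ℝ => (∫ x, x ∂(tiltedLaw μ g s)) - s • ∫ x, g x • x ∂μ) =O[𝓝 0]
      fun s => s ^ 2 := by
  obtain ⟨r, hr, hexp, hint⟩ := exists_integrable_exp_mul_norm hg hLp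
  have hx : Integrable (fun x : B => x) μ :=
    hLp.integrable (by rw [ENNReal.le_div_iff_mul_le] <;> norm_num)
  have hgx : Integrable (fun x => g x • x) μ := integrable_apply_smul hg hLp
  have hg0 : ∫ x, g x ∂μ = 0 := by rw [g.integral_comp_comm hx, h0, map_zero]
  set a := ∫ x, g x • x ∂μ with ha
  set ρ := r / 2 with hρ
  have hρ0 : 0 < ρ := by positivity
  -- the numerator
  have hnum : (fun s : ℝ => (∫ x, Real.exp (s * g x) • x ∂μ) - s • a) =O[𝓝 0]
      fun s => s ^ 2 := by
    refine Asymptotics.IsBigO.of_bound (2 / ρ ^ 2 * ∫ x, Real.exp (r * |g x|) * ‖x‖ ∂μ) ?_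
    filter_upwards [Metric.ball_mem_nhds (0 : ℝ) hρ0, eventually_integrable_exp_smul hg hLp]
      with s hs hsx
    rw [mem_ball_zero_iff, Real.norm_eq_abs] at hs
    have h1 : (∫ x, Real.exp (s * g x) • x ∂μ) - s • a =
        ∫ x, (Real.exp (s * g x) - 1 - s * g x) • x ∂μ := by
      have h2 : ∫ x, (Real.exp (s * g x) - 1 - s * g x) • x ∂μ =
          ∫ x, (Real.exp (s * g x) • x - x - s • g x • x) ∂μ := by
        refine integral_congr_ae (ae_of_all _ fun x => ?_)
        simp only [sub_smul, one_smul, smul_smul]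
      have h3 : Integrable (fun x => Real.exp (s * g x) • x - x) μ := hsx.sub hx
      have h4 : Integrable (fun x => s • g x • x) μ := hgx.smul s
      rw [h2, integral_sub h3 h4, integral_sub hsx hx, h0, sub_zero, integral_smul]
    rw [h1]
    calc ‖∫ x, (Real.exp (s * g x) - 1 - s * g x) • x ∂μ‖
        ≤ ∫ x, s ^ 2 * (2 / ρ ^ 2) * (Real.exp (r * |g x|) * ‖x‖) ∂μ := by
          refine norm_integral_le_of_norm_le (hint.const_mul _) (ae_of_all _ fun x => ?_)
          rw [norm_smul, Real.norm_eq_abs, ← mul_assoc]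
          refine mul_le_mul_of_nonneg_right ?_ (norm_nonneg _)
          have h2 := Real.pow_div_factorial_le_exp (ρ * |g x|) (by positivity) 2
          norm_num [Nat.factorial] at h2
          have h3 : g x ^ 2 ≤ 2 / ρ ^ 2 * Real.exp (ρ * |g x|) := by
            rw [div_mul_eq_mul_div, le_div_iff₀ (by positivity)]
            have h4 : (ρ * |g x|) ^ 2 = g x ^ 2 * ρ ^ 2 := by rw [mul_pow, sq_abs]; ring
            linarith
          calc |Real.exp (s * g x) - 1 - s * g x|
              ≤ (s * g x) ^ 2 * Real.exp |s * g x| := abs_exp_sub_one_sub_le _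
            _ ≤ s ^ 2 * g x ^ 2 * Real.exp (ρ * |g x|) := by
                rw [mul_pow, abs_mul]
                gcongr
            _ ≤ s ^ 2 * (2 / ρ ^ 2 * Real.exp (ρ * |g x|)) * Real.exp (ρ * |g x|) := by gcongr
            _ = s ^ 2 * (2 / ρ ^ 2) * Real.exp (r * |g x|) := by
                rw [show r * |g x| = ρ * |g x| + ρ * |g x| by rw [hρ]; ring, Real.exp_add]
                ring
      _ = _ := by
          rw [integral_const_mul, norm_pow, Real.norm_eq_abs, sq_abs]
          ring
  -- the normalising constant
  have hM : (fun s : ℝ => (mgf g μ s)⁻¹ - 1) =O[𝓝 0] fun s => s := by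
    have h1 : (fun s : ℝ => mgf g μ s - mgf g μ 0) =O[𝓝 0] fun s => s - 0 :=
      (analyticAt_mgf hg).differentiableAt.isBigO_sub
    simp only [mgf_zero, sub_zero] at h1
    refine Asymptotics.IsBigO.trans (Asymptotics.IsBigO.of_bound 1 ?_) h1
    filter_upwards [Metric.ball_mem_nhds (0 : ℝ) hr] with s hs
    rw [mem_ball_zero_iff, Real.norm_eq_abs] at hs
    have h2 := one_le_mgf hg hg0 (hexp s hs.le)
    rw [one_mul, Real.norm_of_nonneg (by linarith : 0 ≤ mgf g μ s - 1), norm_sub_rev,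
      Real.norm_of_nonneg (by linarith [inv_le_one_of_one_le₀ h2])]
    have h3 : 1 - (mgf g μ s)⁻¹ = (mgf g μ s - 1) / mgf g μ s := by field_simp
    rw [h3]
    exact div_le_self (by linarith) h2
  have hMb : (fun s : ℝ => (mgf g μ s)⁻¹) =O[𝓝 0] fun _ => (1 : ℝ) := by
    refine Asymptotics.IsBigO.of_bound 1 ?_
    filter_upwards [Metric.ball_mem_nhds (0 : ℝ) hr] with s hs
    rw [mem_ball_zero_iff, Real.norm_eq_abs] at hs
    have h2 := one_le_mgf hg hg0 (hexp s hs.le)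
    rw [Real.norm_of_nonneg (by positivity)]
    simpa using inv_le_one_of_one_le₀ h2
  have hdecomp : ∀ s : ℝ, (∫ x, x ∂(tiltedLaw μ g s)) - s • a =
      (mgf g μ s)⁻¹ • ((∫ x, Real.exp (s * g x) • x ∂μ) - s • a) +
        (((mgf g μ s)⁻¹ - 1) * s) • a := by
    intro s
    rw [tiltedLaw_eq, integral_tilted_mul_eq_mgf]
    simp_rw [div_eq_inv_mul, mul_smul]
    rw [integral_smul, smul_sub, sub_smul, one_smul]
    module
  simp_rw [hdecomp]
  refine Asymptotics.IsBigO.add ?_ ?_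
  · simpa using hMb.smul hnum
  · have h1 : (fun s : ℝ => ((mgf g μ s)⁻¹ - 1) * s) =O[𝓝 0] fun s => s ^ 2 := by
      simpa [sq] using hM.mul (Asymptotics.isBigO_refl (fun s : ℝ => s) (𝓝 0))
    simpa using h1.smul (Asymptotics.isBigO_refl (fun _ : ℝ => a) (𝓝 0)) |>.trans
      (Asymptotics.IsBigO.of_bound ‖a‖ (Eventually.of_forall fun s => by
        rw [norm_smul, mul_comm]))

end TiltedMean

section ChangeOfMeasure

variable {B : Type*} [NormedAddCommGroup B] [NormedSpace ℝ B] [MeasurableSpace B]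
  {μ : Measure B} [IsProbabilityMeasure μ] {g : StrongDual ℝ B}

/-- Tilting commutes with forming powers of a law. -/
lemma tiltedPower_eq_tilted {s : ℝ} (hs : Integrable (fun x => Real.exp (s * g x)) μ) (n : ℕ) :
    tiltedPower μ g s n = (Measure.pi fun _ : Fin n => μ).tilted (fun z => ∑ i, s * g (z i)) := by
  have hprob : IsProbabilityMeasure (tiltedLaw μ g s) := by
    rw [tiltedLaw_eq]
    exact isProbabilityMeasure_tilted hs
  refine Measure.pi_eq fun S hS => ?_
  have hZ : ∫ z : Fin n → B, Real.exp (∑ i, s * g (z i)) ∂(Measure.pi fun _ : Fin n => μ) =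
      ∏ _i : Fin n, ∫ x, Real.exp (s * g x) ∂μ := by
    simp_rw [Real.exp_sum]
    exact integral_fintype_prod_eq_prod (fun (_ : Fin n) x => Real.exp (s * g x))
  rw [tilted_apply_eq_ofReal_integral _ (Set.pi univ S), hZ, Measure.restrict_pi_pi]
  simp_rw [Real.exp_sum, ← Finset.prod_div_distrib]
  rw [integral_fintype_prod_eq_prod
    (fun (_ : Fin n) x => Real.exp (s * g x) / ∫ x, Real.exp (s * g x) ∂μ),
    ENNReal.ofReal_prod_of_nonneg fun i _ => integral_nonneg fun x => by positivity]
  refine Finset.prod_congr rfl fun i _ => ?_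
  rw [tiltedLaw_eq, tilted_apply_eq_ofReal_integral]

lemma integral_scaledSum {ν : Measure B} [IsProbabilityMeasure ν]
    (hν : Integrable (fun x : B => x) ν) (n : ℕ) (s : ℝ) :
    ∫ z, scaledSum n s z ∂(Measure.pi fun _ : Fin n => ν) = (s * n) • ∫ x, x ∂ν := by
  simp only [scaledSum]
  rw [integral_smul, integral_finsetSum _ fun i _ => integrable_comp_eval
    (μ := fun _ : Fin n => ν) (i := i) (f := fun x : B => x) hν]
  simp_rw [integral_comp_eval (μ := fun _ : Fin n => ν) (f := fun x : B => x)
    hν.aestronglyMeasurable]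
  simp [mul_smul, ← Nat.cast_smul_eq_nsmul ℝ]

variable [CompleteSpace B]

/-- The value of `g` at the mean of the scaled sum under the tilted law. -/
lemma apply_integral_scaledSum {s : ℝ} (hs : s ∈ interior (integrableExpSet g μ))
    (hint : Integrable (fun x : B => x) (tiltedLaw μ g s)) (n : ℕ) :
    g (∫ w, scaledSum n s w ∂(tiltedPower μ g s n)) = n * (s * deriv (cgf g μ) s) := by
  have hprob : IsProbabilityMeasure (tiltedLaw μ g s) := by
    rw [tiltedLaw_eq]
    exact isProbabilityMeasure_tilted (interior_subset (s := integrableExpSet g μ) hs)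
  rw [tiltedPower, integral_scaledSum hint, map_smul, ← g.integral_comp_comm hint, tiltedLaw_eq,
    integral_tilted_mul_self hs, smul_eq_mul]
  ring

variable [BorelSpace B] [SecondCountableTopology B]

/-- The exponential change of measure, as an exact identity. -/
lemma measureReal_eq_exp_mul_tiltedExpectation {s : ℝ}
    (hs : s ∈ interior (integrableExpSet g μ))
    (hint : Integrable (fun x : B => x) (tiltedLaw μ g s)) (n : ℕ) {A : Set B}
    (hA : MeasurableSet A) :
    (Measure.pi fun _ : Fin n => μ).real {z | scaledSum n s z ∈ A} =
      Real.exp (n * (cgf g μ s - s * deriv (cgf g μ) s)) * tiltedExpectation μ g s n A := by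
  have hsint : Integrable (fun x => Real.exp (s * g x)) μ :=
    interior_subset (s := integrableExpSet g μ) hs
  have hmeas : MeasurableSet {z : Fin n → B | scaledSum n s z ∈ A} := by
    have : Measurable (fun z : Fin n → B => scaledSum n s z) := by
      unfold scaledSum
      fun_prop
    exact this hA
  set m := g (∫ w, scaledSum n s w ∂(tiltedPower μ g s n)) with hm
  have hZ : ∫ z : Fin n → B, Real.exp (∑ i, s * g (z i)) ∂(Measure.pi fun _ : Fin n => μ) =
      Real.exp (n * cgf g μ s) := by
    simp_rw [Real.exp_sum]
    rw [integral_fintype_prod_eq_prod (fun (_ : Fin n) x => Real.exp (s * g x)),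
      Finset.prod_const, Finset.card_univ, Fintype.card_fin, Real.exp_nat_mul, exp_cgf hsint]
    rfl
  have hval : tiltedExpectation μ g s n A =
      Real.exp (m - n * cgf g μ s) *
        (Measure.pi fun _ : Fin n => μ).real {z | scaledSum n s z ∈ A} := by
    rw [tiltedExpectation]
    simp_rw [map_sub]
    rw [← hm, tiltedPower_eq_tilted hsint, setIntegral_tilted' _ _ hmeas, hZ]
    have h1 : ∀ z : Fin n → B, (Real.exp (∑ i, s * g (z i)) / Real.exp (n * cgf g μ s)) •
        Real.exp (-(g (scaledSum n s z) - m)) = Real.exp (m - n * cgf g μ s) := by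
      intro z
      rw [smul_eq_mul, ← Real.exp_sub, ← Real.exp_add, scaledSum, map_smul, map_sum, smul_eq_mul,
        Finset.mul_sum]
      congr 1
      ring
    simp_rw [h1]
    rw [setIntegral_const, smul_eq_mul, mul_comm]
  rw [hval, ← mul_assoc, ← Real.exp_add, hm, apply_integral_scaledSum hs hint]
  ring_nf
  simp

end ChangeOfMeasure

/-! ### Gaussian smoothing -/

section Smoothing

/-- Fourier inversion for the Gaussian density. -/
lemma gaussianPDFReal_eq_charFun {v : NNReal} (hv : v ≠ 0) (t : ℝ) :
    (gaussianPDFReal 0 v t : ℂ) =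
      ((Real.sqrt (2 * Real.pi * v))⁻¹ : ℝ) * charFun (gaussianReal 0 v⁻¹) t := by
  have hv' : (v : ℂ) ≠ 0 := by exact_mod_cast hv
  rw [charFun_gaussianReal, gaussianPDFReal]
  push_cast
  congr 2
  field_simp
  simp [sq]

/-- The density of a law smoothed by a Gaussian one is bounded by a Gaussian average of the modulus
of its characteristic function. -/
lemma integral_gaussianPDFReal_sub_le (ρ : Measure ℝ) [IsProbabilityMeasure ρ] {v : NNReal}
    (hv : v ≠ 0) (x : ℝ) :
    ∫ w, gaussianPDFReal 0 v (x - w) ∂ρ ≤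
      (Real.sqrt (2 * Real.pi * v))⁻¹ * ∫ u, ‖charFun ρ u‖ ∂(gaussianReal 0 v⁻¹) := by
  have h1 : ((∫ w, gaussianPDFReal 0 v (x - w) ∂ρ : ℝ) : ℂ) =
      ((Real.sqrt (2 * Real.pi * v))⁻¹ : ℝ) *
        ∫ u, Complex.exp (x * u * Complex.I) * charFun ρ (-u) ∂(gaussianReal 0 v⁻¹) := by
    rw [← integral_complex_ofReal]
    simp_rw [gaussianPDFReal_eq_charFun hv]
    rw [integral_const_mul]
    congr 1
    simp_rw [charFun_apply_real]
    rw [integral_integral_swap]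
    · refine integral_congr_ae (ae_of_all _ fun u => ?_)
      simp only
      rw [← integral_const_mul]
      refine integral_congr_ae (ae_of_all _ fun w => ?_)
      simp only
      rw [← Complex.exp_add]
      congr 1
      push_cast
      ring
    · refine Integrable.mono' (integrable_const (1 : ℝ)) (by fun_prop) (ae_of_all _ fun p => ?_)
      simp only [Function.uncurry]
      rw [← Complex.ofReal_mul, Complex.norm_exp_ofReal_mul_I]
  have h2 : 0 ≤ ∫ w, gaussianPDFReal 0 v (x - w) ∂ρ :=
    integral_nonneg fun w => gaussianPDFReal_nonneg _ _ _
  rw [← Real.norm_of_nonneg h2, ← Complex.norm_real, h1, norm_mul, Complex.norm_real,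
    Real.norm_of_nonneg (by positivity)]
  gcongr
  refine (norm_integral_le_integral_norm _).trans_eq (integral_congr_ae (ae_of_all _ fun u => ?_))
  simp only
  rw [norm_mul, ← Complex.ofReal_mul, Complex.norm_exp_ofReal_mul_I, one_mul, charFun_neg]
  simp

/-- Smoothing inequality: the exponentially weighted mass of `[-ε, ∞)` is controlled by a bound `M`
for the density of the law smoothed by a centered Gaussian law. -/
lemma setLIntegral_exp_neg_mul_le (ρ : Measure ℝ) [IsProbabilityMeasure ρ] {v : NNReal}
    (hv : v ≠ 0) {a ε M : ℝ}
    (hM : ∀ x, ∫ w, gaussianPDFReal 0 v (x - w) ∂ρ ≤ M) :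
    (∫⁻ w in Ici (-ε), ENNReal.ofReal (Real.exp (-w)) ∂ρ) * gaussianReal 0 v (Icc (-a) a) ≤
      ENNReal.ofReal (Real.exp (2 * a + ε) * M) := by
  set h : ℝ → ℝ≥0∞ := (Ici (-ε - a)).indicator fun x => ENNReal.ofReal (Real.exp (a - x)) with hh
  have hhm : Measurable h := Measurable.indicator (by fun_prop) measurableSet_Ici
  have hpm : Measurable fun p : ℝ × ℝ => gaussianPDF 0 v (p.2 - p.1) := by fun_prop
  have hpoint : ∀ w ∈ Ici (-ε), ENNReal.ofReal (Real.exp (-w)) * gaussianReal 0 v (Icc (-a) a) ≤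
      ∫⁻ x, h x * gaussianPDF 0 v (x - w) := by
    intro w hw
    rw [gaussianReal_apply _ hv, ← lintegral_indicator measurableSet_Icc,
      ← lintegral_sub_right_eq_self _ w, ← lintegral_const_mul _ (by
        refine Measurable.comp (g := (Icc (-a) a).indicator fun x => gaussianPDF 0 v x)
          (Measurable.indicator (by fun_prop) measurableSet_Icc) (by fun_prop))]
    refine lintegral_mono fun x => ?_
    by_cases hx : x - w ∈ Icc (-a) a
    · have hx' : x ∈ Ici (-ε - a) := by
        simp only [mem_Icc, mem_Ici] at hx hw ⊢
        linarith
      rw [indicator_of_mem hx, hh, indicator_of_mem hx']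
      gcongr
      linarith [hx.2]
    · rw [indicator_of_notMem hx]
      simp
  have hMx : ∀ x, ∫⁻ w, gaussianPDF 0 v (x - w) ∂ρ ≤ ENNReal.ofReal M := by
    intro x
    refine le_trans (le_of_eq ?_) (ENNReal.ofReal_le_ofReal (hM x))
    rw [ofReal_integral_eq_lintegral_ofReal _ (ae_of_all _ fun w => gaussianPDFReal_nonneg _ _ _)]
    · rfl
    · refine Integrable.mono' (integrable_const (Real.sqrt (2 * Real.pi * v))⁻¹)
        ((measurable_gaussianPDFReal 0 v).comp
          (measurable_const.sub measurable_id)).aestronglyMeasurable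
        (ae_of_all _ fun w => ?_)
      rw [Real.norm_of_nonneg (gaussianPDFReal_nonneg _ _ _), gaussianPDFReal]
      refine mul_le_of_le_one_right (by positivity) (Real.exp_le_one_iff.2 ?_)
      exact div_nonpos_of_nonpos_of_nonneg (neg_nonpos.2 (sq_nonneg _)) (by positivity)
  have hint : ∫⁻ x, h x = ENNReal.ofReal (Real.exp (2 * a + ε)) := by
    have h1 : ∀ x : ℝ, Real.exp (a - x) = Real.exp a * Real.exp (-x) := fun x => by
      rw [← Real.exp_add, sub_eq_add_neg]
    rw [hh, lintegral_indicator measurableSet_Ici, setLIntegral_congr Ioi_ae_eq_Ici.symm]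
    simp_rw [h1]
    rw [← ofReal_integral_eq_lintegral_ofReal
      ((integrableOn_exp_neg_Ioi (-ε - a)).const_mul (Real.exp a))
      (ae_of_all _ fun x => by positivity), integral_const_mul, integral_exp_neg_Ioi,
      ← Real.exp_add]
    congr 2
    ring
  calc (∫⁻ w in Ici (-ε), ENNReal.ofReal (Real.exp (-w)) ∂ρ) * gaussianReal 0 v (Icc (-a) a)
      = ∫⁻ w in Ici (-ε), ENNReal.ofReal (Real.exp (-w)) * gaussianReal 0 v (Icc (-a) a) ∂ρ :=
        (lintegral_mul_const _ (by fun_prop)).symm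
    _ ≤ ∫⁻ w in Ici (-ε), (∫⁻ x, h x * gaussianPDF 0 v (x - w)) ∂ρ :=
        setLIntegral_mono' measurableSet_Ici hpoint
    _ ≤ ∫⁻ w, (∫⁻ x, h x * gaussianPDF 0 v (x - w)) ∂ρ := setLIntegral_le_lintegral _ _
    _ = ∫⁻ x, (∫⁻ w, h x * gaussianPDF 0 v (x - w) ∂ρ) :=
        lintegral_lintegral_swap ((hhm.comp measurable_snd).mul hpm).aemeasurable
    _ = ∫⁻ x, h x * ∫⁻ w, gaussianPDF 0 v (x - w) ∂ρ := by
        refine lintegral_congr fun x => ?_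
        rw [lintegral_const_mul _ (by fun_prop)]
    _ ≤ ∫⁻ x, h x * ENNReal.ofReal M := by
        refine lintegral_mono fun x => ?_
        gcongr
        exact hMx x
    _ = ENNReal.ofReal (Real.exp (2 * a + ε) * M) := by
        rw [lintegral_mul_const _ hhm, hint, ENNReal.ofReal_mul (Real.exp_pos _).le]

/-- Chebyshev's inequality for the smoothing kernel. -/
lemma one_sub_le_gaussianReal_Icc (v : NNReal) {a : ℝ} (ha : 0 < a) :
    1 - v / a ^ 2 ≤ (gaussianReal 0 v).real (Icc (-a) a) := by
  have h1 := meas_ge_le_variance_div_sq (memLp_id_gaussianReal (μ := 0) (v := v) 2) ha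
  simp only [variance_id_gaussianReal, id_eq, integral_id_gaussianReal, sub_zero] at h1
  have h2 : (gaussianReal 0 v).real (Icc (-a) a)ᶜ ≤ v / a ^ 2 := by
    refine ENNReal.toReal_le_of_le_ofReal (by positivity) (le_trans (measure_mono ?_) h1)
    intro x hx
    rw [mem_ofPred]
    by_contra! hcon
    exact hx (abs_le.1 hcon.le)
  rw [probReal_compl_eq_one_sub measurableSet_Icc] at h2
  linarith

/-- Gaussian average of a Gaussian function, with the density bounded by its maximum. -/
lemma integral_exp_neg_mul_sq_gaussianReal_le {v : NNReal} (hv : v ≠ 0) {κ : ℝ} (hκ : 0 < κ) :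
    (Real.sqrt (2 * Real.pi * v))⁻¹ *
        ∫ u, Real.exp (-(κ * u ^ 2 / 2)) ∂(gaussianReal 0 v⁻¹) ≤
      (Real.sqrt (2 * Real.pi * κ))⁻¹ := by
  have hv0 : (0 : ℝ) < v := by exact_mod_cast pos_iff_ne_zero.2 hv
  have hint : Integrable fun u : ℝ => Real.exp (-(κ / 2) * u ^ 2) :=
    integrable_exp_neg_mul_sq (by positivity)
  have h1 : ∫ u, Real.exp (-(κ * u ^ 2 / 2)) ∂(gaussianReal 0 v⁻¹) ≤
      (Real.sqrt (2 * Real.pi * (v⁻¹ : NNReal)))⁻¹ * Real.sqrt (Real.pi / (κ / 2)) := by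
    rw [integral_gaussianReal_eq_integral_smul (inv_ne_zero hv), ← integral_gaussian,
      ← integral_const_mul]
    refine integral_mono_of_nonneg (ae_of_all _ fun u => ?_) (hint.const_mul _)
      (ae_of_all _ fun u => ?_)
    · exact smul_nonneg (gaussianPDFReal_nonneg _ _ _) (Real.exp_pos _).le
    · simp only [smul_eq_mul]
      rw [show -(κ / 2) * u ^ 2 = -(κ * u ^ 2 / 2) by ring]
      gcongr
      rw [gaussianPDFReal]
      refine mul_le_of_le_one_right (by positivity) (Real.exp_le_one_iff.2 ?_)
      exact div_nonpos_of_nonpos_of_nonneg (neg_nonpos.2 (sq_nonneg _)) (by positivity)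
  calc (Real.sqrt (2 * Real.pi * v))⁻¹ *
        ∫ u, Real.exp (-(κ * u ^ 2 / 2)) ∂(gaussianReal 0 v⁻¹)
      ≤ (Real.sqrt (2 * Real.pi * v))⁻¹ *
        ((Real.sqrt (2 * Real.pi * (v⁻¹ : NNReal)))⁻¹ * Real.sqrt (Real.pi / (κ / 2))) := by gcongr
    _ = (Real.sqrt (2 * Real.pi * κ))⁻¹ := by
        rw [← Real.sqrt_inv, ← Real.sqrt_inv, ← Real.sqrt_inv, ← Real.sqrt_mul (by positivity),
          ← Real.sqrt_mul (by positivity)]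
        congr 1
        push_cast
        field_simp

end Smoothing

/-! ### The upper bound for the tilted expectation -/

section LocalBound

variable {B : Type*} [NormedAddCommGroup B] [NormedSpace ℝ B] [MeasurableSpace B]
  {μ : Measure B} {g : StrongDual ℝ B}

lemma tiltedExpectation_nonneg (μ : Measure B) (g : StrongDual ℝ B) (s : ℝ) (n : ℕ) (A : Set B) :
    0 ≤ tiltedExpectation μ g s n A :=
  integral_nonneg fun _ => (Real.exp_pos _).le

variable [BorelSpace B] [SecondCountableTopology B] [IsProbabilityMeasure μ]

/-- The characteristic function of the image of the scaled sum under `g` factorises. -/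
lemma norm_charFun_map_scaledSum {ν : Measure B} [IsProbabilityMeasure ν] (s : ℝ) (n : ℕ) (y : B)
    (u : ℝ) :
    ‖charFun ((Measure.pi fun _ : Fin n => ν).map fun z => g (scaledSum n s z - y)) u‖ =
      ‖charFun (ν.map g) (s * u)‖ ^ n := by
  have hm : Measurable fun z : Fin n → B => g (scaledSum n s z - y) := by
    unfold scaledSum
    fun_prop
  rw [charFun_apply_real, charFun_apply_real, integral_map hm.aemeasurable (by fun_prop),
    integral_map (by fun_prop) (by fun_prop)]
  have h1 : ∀ z : Fin n → B, Complex.exp (u * (g (scaledSum n s z - y) : ℝ) * Complex.I) =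
      Complex.exp (((-(u * g y) : ℝ) : ℂ) * Complex.I) *
        ∏ i, Complex.exp ((s * u : ℝ) * (g (z i) : ℝ) * Complex.I) := by
    intro z
    rw [← Complex.exp_sum, ← Complex.exp_add, scaledSum, map_sub, map_smul, map_sum,
      ← Finset.sum_mul, ← Finset.mul_sum]
    congr 1
    push_cast
    rw [smul_eq_mul]
    push_cast
    ring
  simp_rw [h1]
  rw [integral_const_mul, norm_mul, Complex.norm_exp_ofReal_mul_I, one_mul,
    integral_fintype_prod_eq_prod
      (fun (_ : Fin n) x => Complex.exp ((s * u : ℝ) * (g x : ℝ) * Complex.I)),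
    Finset.prod_const, Finset.card_univ, Fintype.card_fin, norm_pow]

/-- Non-asymptotic bound for the tilted expectation over a set lying in the half-space
`g ≥ g (E T) - ε`, in terms of the characteristic function of one tilted summand. -/
lemma tiltedExpectation_mul_le {s : ℝ} (hs : Integrable (fun x => Real.exp (s * g x)) μ) (n : ℕ)
    {A : Set B} {ε : ℝ}
    (hgA : ∀ x ∈ A, g (∫ w, scaledSum n s w ∂(tiltedPower μ g s n)) - ε ≤ g x)
    {v : NNReal} (hv : v ≠ 0) (a : ℝ) :
    tiltedExpectation μ g s n A * (gaussianReal 0 v).real (Icc (-a) a) ≤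
      Real.exp (2 * a + ε) * ((Real.sqrt (2 * Real.pi * v))⁻¹ *
        ∫ u, ‖charFun ((tiltedLaw μ g s).map g) (s * u)‖ ^ n ∂(gaussianReal 0 v⁻¹)) := by
  have hprob : IsProbabilityMeasure (tiltedLaw μ g s) := by
    rw [tiltedLaw_eq]
    exact isProbabilityMeasure_tilted hs
  set y := ∫ w, scaledSum n s w ∂(tiltedPower μ g s n) with hy
  set Q := Measure.pi fun _ : Fin n => tiltedLaw μ g s with hQ
  have hT : Measurable fun z : Fin n → B => scaledSum n s z := by
    unfold scaledSum
    fun_prop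
  have hm : Measurable fun z : Fin n → B => g (scaledSum n s z - y) := by fun_prop
  set ρ := Q.map fun z => g (scaledSum n s z - y) with hρ
  have hρp : IsProbabilityMeasure ρ := Measure.isProbabilityMeasure_map hm.aemeasurable
  have hM := integral_gaussianPDFReal_sub_le ρ hv
  simp_rw [hρ, hQ, norm_charFun_map_scaledSum] at hM
  have h1 := setLIntegral_exp_neg_mul_le ρ hv (a := a) (ε := ε) hM
  have h2 : tiltedExpectation μ g s n A ≤
      (∫⁻ w in Ici (-ε), ENNReal.ofReal (Real.exp (-w)) ∂ρ).toReal := by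
    have hfin : ∫⁻ w in Ici (-ε), ENNReal.ofReal (Real.exp (-w)) ∂ρ ≠ ∞ := by
      refine ne_of_lt (lt_of_le_of_lt (setLIntegral_mono' (g := fun _ => ENNReal.ofReal
        (Real.exp ε)) measurableSet_Ici fun w hw => ?_) ?_)
      · gcongr
        linarith [mem_Ici.1 hw]
      · rw [setLIntegral_const]
        exact ENNReal.mul_lt_top ENNReal.ofReal_lt_top (measure_lt_top _ _)
    rw [tiltedExpectation, tiltedPower, ← hQ]
    rw [integral_eq_lintegral_of_nonneg_ae (ae_of_all _ fun z => (Real.exp_pos _).le)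
      (by fun_prop)]
    refine ENNReal.toReal_mono hfin ?_
    rw [hρ, setLIntegral_map measurableSet_Ici (by fun_prop) hm]
    refine lintegral_mono_set fun z hz => ?_
    have h3 := hgA _ (mem_ofPred.1 hz)
    rw [mem_preimage, mem_Ici, map_sub]
    linarith
  refine (mul_le_mul_of_nonneg_right h2 measureReal_nonneg).trans ?_
  rw [Measure.real, ← ENNReal.toReal_mul]
  refine ENNReal.toReal_le_of_le_ofReal ?_ h1
  have : 0 ≤ ∫ u, ‖charFun ((tiltedLaw μ g s).map g) (s * u)‖ ^ n ∂(gaussianReal 0 v⁻¹) :=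
    integral_nonneg fun _ => by positivity
  positivity

/-- The upper bound of local-limit type for the tilted expectation. -/
lemma eventually_mul_tiltedExpectation_le [CompleteSpace B]
    (hg : 0 ∈ interior (integrableExpSet g μ))
    (hLp : MemLp (fun x : B => x) (3 / 2) μ) (h0 : ∫ x, g x ∂μ = 0)
    (hσ : 0 < ∫ x, g x ^ 2 ∂μ) {s : ℕ → ℝ} (hpos : ∀ᶠ n in atTop, 0 < s n)
    (hs0 : Tendsto s atTop (𝓝 0)) (hs3 : Tendsto (fun n : ℕ => n * s n ^ 3) atTop (𝓝 0))
    {A : ℕ → Set B}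
    (hgA : ∀ᶠ n in atTop, ∀ x ∈ A n, n * s n ^ 2 * ∫ x, g x ^ 2 ∂μ ≤ g x)
    {C : ℝ} (hC : (Real.sqrt (2 * Real.pi * ∫ x, g x ^ 2 ∂μ))⁻¹ < C) :
    ∀ᶠ n : ℕ in atTop, s n * Real.sqrt n * tiltedExpectation μ g (s n) n (A n) ≤ C := by
  set σ := ∫ x, g x ^ 2 ∂μ with hσdef
  -- a single small parameter `a` governs the window, the kernel and the loss in the variance
  obtain ⟨a, ha0, ha1, haC⟩ : ∃ a : ℝ, 0 < a ∧ a < 1 ∧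
      Real.exp (3 * a) * ((Real.sqrt (2 * Real.pi * ((1 - a) * σ)))⁻¹ + a) < C * (1 - a) := by
    have hl : ContinuousAt (fun a : ℝ =>
        Real.exp (3 * a) * ((Real.sqrt (2 * Real.pi * ((1 - a) * σ)))⁻¹ + a)) 0 := by
      refine ContinuousAt.mul (by fun_prop) (ContinuousAt.add (ContinuousAt.inv₀ (by fun_prop) ?_)
        continuousAt_id)
      rw [sub_zero, one_mul]
      positivity
    have hr : ContinuousAt (fun a : ℝ => C * (1 - a)) 0 := by fun_prop
    have hev := hl.eventually_lt hr (by simpa using hC)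
    obtain ⟨e, he, hball⟩ := Metric.eventually_nhds_iff_ball.1 hev
    have h1 : 0 < min (e / 2) (1 / 2) := by positivity
    refine ⟨min (e / 2) (1 / 2), h1, (min_le_right _ _).trans_lt (by norm_num), hball _ ?_⟩
    rw [mem_ball_zero_iff, Real.norm_of_nonneg h1.le]
    exact (min_le_left _ _).trans_lt (by linarith)
  set v : NNReal := ⟨a ^ 3, by positivity⟩ with hv
  have hvr : (v : ℝ) = a ^ 3 := rfl
  have hv0 : v ≠ 0 := by
    intro h
    have : (v : ℝ) = 0 := by rw [h]; rfl
    rw [hvr] at this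
    exact (pow_pos ha0 3).ne' this
  have hkernel : 1 - a ≤ (gaussianReal 0 v).real (Icc (-a) a) := by
    have h1 := one_sub_le_gaussianReal_Icc v ha0
    rwa [hvr, show a ^ 3 / a ^ 2 = a by field_simp] at h1
  obtain ⟨c, hc, hchar⟩ := exists_norm_charFun_tilted_le hg h0 hσ ha0
  obtain ⟨K, hK0, hK⟩ := (deriv_cgf_sub_isBigO hg h0).exists_pos
  have hK' := hs0.eventually hK.bound
  -- the displacement of the mean
  have hε : ∀ᶠ n : ℕ in atTop, K * (n * s n ^ 3) ≤ a := by
    have := (hs3.const_mul K)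
    rw [mul_zero] at this
    exact (this.eventually (gt_mem_nhds ha0)).mono fun n hn => hn.le
  -- the contribution of the frequencies where the characteristic function is not controlled
  set L := (Real.sqrt (2 * Real.pi * v))⁻¹ * ((v⁻¹ : NNReal) / c ^ 2) with hL
  have hL0 : 0 ≤ L := by positivity
  have htail : ∀ᶠ n : ℕ in atTop, L * (n * s n ^ 3) ≤ a := by
    have := (hs3.const_mul L)
    rw [mul_zero] at this
    exact (this.eventually (gt_mem_nhds ha0)).mono fun n hn => hn.le
  filter_upwards [hpos, hgA, hK', hε, htail, eventually_gt_atTop 0,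
    hs0.eventually hchar, hs0.eventually (isOpen_interior.mem_nhds hg),
    hs0.eventually (eventually_integrable_tiltedLaw hg hLp)]
    with n hsn hgAn hKn hεn htailn hn0 hcharn hsint hint
  have hn : (1 : ℝ) ≤ n := by exact_mod_cast hn0
  have hexpint : Integrable (fun x => Real.exp (s n * g x)) μ :=
    interior_subset (s := integrableExpSet g μ) hsint
  have hmain := tiltedExpectation_mul_le (μ := μ) (g := g) hexpint n (A := A n) (ε := a) (by
    intro x hx
    rw [apply_integral_scaledSum hsint hint]
    refine le_trans ?_ (hgAn x hx)
    rw [norm_pow, Real.norm_eq_abs, Real.norm_eq_abs, abs_of_pos hsn] at hKn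
    have h2 := (le_abs_self _).trans hKn
    have h3 : n * s n * (deriv (cgf g μ) (s n) - s n * σ) ≤ n * s n * (K * s n ^ 2) := by gcongr
    have h4 : n * s n * (K * s n ^ 2) = K * (n * s n ^ 3) := by ring
    linarith) hv0 a
  set κ := (1 - a) * σ * (n * s n ^ 2) with hκ
  have h1a : 0 < 1 - a := by linarith
  have hκ0 : 0 < κ := by positivity
  set I := ∫ u, ‖charFun ((tiltedLaw μ g (s n)).map g) (s n * u)‖ ^ n ∂(gaussianReal 0 v⁻¹)
    with hI
  have hprob : IsProbabilityMeasure (tiltedLaw μ g (s n)) := by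
    rw [tiltedLaw_eq]
    exact isProbabilityMeasure_tilted hexpint
  have hprob' : IsProbabilityMeasure ((tiltedLaw μ g (s n)).map g) :=
    Measure.isProbabilityMeasure_map (by fun_prop)
  have hIle : I ≤ (∫ u, Real.exp (-(κ * u ^ 2 / 2)) ∂(gaussianReal 0 v⁻¹)) +
      s n ^ 2 * ((v⁻¹ : NNReal) / c ^ 2) := by
    have hi1 : Integrable (fun u : ℝ => Real.exp (-(κ * u ^ 2 / 2))) (gaussianReal 0 v⁻¹) := by
      refine Integrable.mono' (integrable_const (1 : ℝ)) (by fun_prop) (ae_of_all _ fun u => ?_)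
      rw [Real.norm_of_nonneg (Real.exp_pos _).le]
      refine Real.exp_le_one_iff.2 ?_
      have : 0 ≤ κ * u ^ 2 / 2 := by positivity
      linarith
    have hsq : ∫ u, u ^ 2 ∂(gaussianReal 0 v⁻¹) = (v⁻¹ : NNReal) := by
      have h2 := variance_fun_id_gaussianReal (μ := 0) (v := v⁻¹)
      rwa [variance_of_integral_eq_zero (by fun_prop) (by simp)] at h2
    have hi2 : Integrable (fun u : ℝ => u ^ 2) (gaussianReal 0 v⁻¹) :=
      (memLp_id_gaussianReal (μ := 0) (v := v⁻¹) 2).integrable_sq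
    have h3 : s n ^ 2 * ((v⁻¹ : NNReal) / c ^ 2) =
        ∫ u, (s n ^ 2 / c ^ 2) * u ^ 2 ∂(gaussianReal 0 v⁻¹) := by
      rw [integral_const_mul, hsq]
      ring
    rw [h3, ← integral_add hi1 (hi2.const_mul _)]
    refine integral_mono_of_nonneg (ae_of_all _ fun u => by positivity)
      (hi1.add (hi2.const_mul _)) (ae_of_all _ fun u => ?_)
    simp only
    rcases le_or_gt |s n * u| c with hu | hu
    · have h4 := hcharn (s n * u) hu
      rw [← tiltedLaw_eq] at h4
      have h5 : ‖charFun ((tiltedLaw μ g (s n)).map g) (s n * u)‖ ^ n ≤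
          Real.exp (-(κ * u ^ 2 / 2)) := by
        refine (pow_le_pow_left₀ (norm_nonneg _) h4 n).trans_eq ?_
        rw [← Real.exp_nat_mul, hκ]
        congr 1
        ring
      have h6 : 0 ≤ s n ^ 2 / c ^ 2 * u ^ 2 := by positivity
      linarith
    · have h4 : ‖charFun ((tiltedLaw μ g (s n)).map g) (s n * u)‖ ^ n ≤ 1 :=
        pow_le_one₀ (norm_nonneg _) (norm_charFun_le_one _)
      have h5 : 1 ≤ s n ^ 2 / c ^ 2 * u ^ 2 := by
        rw [div_mul_eq_mul_div, le_div_iff₀ (by positivity), one_mul, ← mul_pow, ← sq_abs (s n * u)]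
        gcongr
      have h6 := Real.exp_pos (-(κ * u ^ 2 / 2))
      linarith
  set TE := tiltedExpectation μ g (s n) n (A n) with hTE
  have hTE0 : 0 ≤ TE := tiltedExpectation_nonneg _ _ _ _ _
  have hsq : 0 < Real.sqrt n := Real.sqrt_pos.2 (by linarith)
  have hgauss := integral_exp_neg_mul_sq_gaussianReal_le hv0 hκ0
  have hscale : s n * Real.sqrt n * (Real.sqrt (2 * Real.pi * κ))⁻¹ =
      (Real.sqrt (2 * Real.pi * ((1 - a) * σ)))⁻¹ := by
    have h2 : Real.sqrt (2 * Real.pi * κ) =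
        Real.sqrt (2 * Real.pi * ((1 - a) * σ)) * (s n * Real.sqrt n) := by
      have h3 : 2 * Real.pi * κ = 2 * Real.pi * ((1 - a) * σ) * (s n * Real.sqrt n) ^ 2 := by
        rw [mul_pow, Real.sq_sqrt (by linarith), hκ]
        ring
      rw [h3, Real.sqrt_mul (by positivity), Real.sqrt_sq (by positivity)]
    rw [h2, mul_inv, mul_comm, mul_assoc, inv_mul_cancel₀ (by positivity), mul_one]
  have hrest : s n * Real.sqrt n * ((Real.sqrt (2 * Real.pi * v))⁻¹ *
      (s n ^ 2 * ((v⁻¹ : NNReal) / c ^ 2))) ≤ a := by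
    have h2 : Real.sqrt n ≤ n := Real.sqrt_le_iff.2 ⟨by linarith, by nlinarith⟩
    calc s n * Real.sqrt n * ((Real.sqrt (2 * Real.pi * v))⁻¹ *
          (s n ^ 2 * ((v⁻¹ : NNReal) / c ^ 2))) = L * (Real.sqrt n * s n ^ 3) := by
          rw [hL]; ring
      _ ≤ L * (n * s n ^ 3) := by gcongr
      _ ≤ a := htailn
  have hfinal : s n * Real.sqrt n * TE * (1 - a) ≤ C * (1 - a) := by
    calc s n * Real.sqrt n * TE * (1 - a)
        ≤ s n * Real.sqrt n * (TE * (gaussianReal 0 v).real (Icc (-a) a)) := by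
          rw [mul_assoc (s n * Real.sqrt n)]
          gcongr
      _ ≤ s n * Real.sqrt n * (Real.exp (2 * a + a) * ((Real.sqrt (2 * Real.pi * v))⁻¹ * I)) := by
          gcongr
      _ ≤ s n * Real.sqrt n * (Real.exp (2 * a + a) * ((Real.sqrt (2 * Real.pi * v))⁻¹ *
          ((∫ u, Real.exp (-(κ * u ^ 2 / 2)) ∂(gaussianReal 0 v⁻¹)) +
            s n ^ 2 * ((v⁻¹ : NNReal) / c ^ 2)))) := by gcongr
      _ = Real.exp (3 * a) * (s n * Real.sqrt n * ((Real.sqrt (2 * Real.pi * v))⁻¹ *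
            ∫ u, Real.exp (-(κ * u ^ 2 / 2)) ∂(gaussianReal 0 v⁻¹)) +
          s n * Real.sqrt n * ((Real.sqrt (2 * Real.pi * v))⁻¹ *
            (s n ^ 2 * ((v⁻¹ : NNReal) / c ^ 2)))) := by
          rw [show 2 * a + a = 3 * a by ring]
          ring
      _ ≤ Real.exp (3 * a) * (s n * Real.sqrt n * (Real.sqrt (2 * Real.pi * κ))⁻¹ + a) := by gcongr
      _ ≤ C * (1 - a) := by rw [hscale]; exact haC.le
  exact le_of_mul_le_mul_right hfinal h1a

end LocalBound

/-! ### Positivity of the probabilities -/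

section Positivity

/-- A number `n` is cut into blocks of length about `t ^ (-2)`, the last one slightly longer, in
such a way that the square roots of the lengths add up to about `n t`. -/
lemma exists_block_decomposition {n : ℕ} {t : ℝ} (ht0 : 0 < t) (ht1 : t < 1)
    (h4 : 4 ≤ n * t ^ 2) :
    ∃ k m q : ℕ, (t ^ 2)⁻¹ ≤ m ∧ (k + 1) * m + (m + q) = n ∧
      (((k + 1 : ℕ) : ℝ) * Real.sqrt m + Real.sqrt (m + q : ℕ)) / (n * t) ≤ 1 ∧
      1 - (t ^ 2 + 2 / (n * t ^ 2)) ≤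
        (((k + 1 : ℕ) : ℝ) * Real.sqrt m + Real.sqrt (m + q : ℕ)) / (n * t) := by
  have hn : (0 : ℝ) < n := by
    by_contra! h
    have : n * t ^ 2 ≤ 0 := mul_nonpos_of_nonpos_of_nonneg h (sq_nonneg t)
    linarith
  set m := ⌈(t ^ 2)⁻¹⌉₊ with hm
  have hmge : (t ^ 2)⁻¹ ≤ m := Nat.le_ceil _
  have hmlt : (m : ℝ) < (t ^ 2)⁻¹ + 1 := Nat.ceil_lt_add_one (by positivity)
  have hm0 : 0 < m := Nat.ceil_pos.2 (by positivity)
  have hm0' : (0 : ℝ) < m := by exact_mod_cast hm0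
  have ht2 : t ^ 2 ≤ 1 := pow_le_one₀ ht0.le ht1.le
  have hmt1 : 1 ≤ m * t ^ 2 := by
    rwa [inv_le_iff_one_le_mul₀ (by positivity)] at hmge
  have hmt2 : m * t ^ 2 ≤ 1 + t ^ 2 := by
    have : (m : ℝ) * t ^ 2 ≤ ((t ^ 2)⁻¹ + 1) * t ^ 2 := by gcongr
    rwa [add_mul, inv_mul_cancel₀ (by positivity), one_mul] at this
  -- at least two blocks
  have h2m : 2 * m ≤ n := by
    have h1 : (2 * m : ℝ) * t ^ 2 ≤ n * t ^ 2 := by linarith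
    have h2 := le_of_mul_le_mul_right h1 (by positivity : 0 < t ^ 2)
    exact_mod_cast h2
  obtain ⟨k, hk⟩ : ∃ k, n / m = k + 1 + 1 := by
    have : 2 ≤ n / m := (Nat.le_div_iff_mul_le hm0).2 h2m
    exact ⟨n / m - 2, by omega⟩
  have hdiv := Nat.div_add_mod n m
  set q := n % m with hq
  have hqm : q < m := Nat.mod_lt _ hm0
  have hn_eq : (k + 1) * m + (m + q) = n := by
    rw [hk] at hdiv
    rw [← hdiv]
    ring
  have hsm : 0 < Real.sqrt m := Real.sqrt_pos.2 hm0'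
  set w := ((k + 1 : ℕ) : ℝ) * Real.sqrt m + Real.sqrt (m + q : ℕ) with hw
  -- the total weight `w` of the blocks is close to `n t`
  have hmq1 : (m : ℝ) ≤ Real.sqrt m * Real.sqrt (m + q : ℕ) := by
    rw [← Real.sqrt_mul hm0'.le]
    refine Real.le_sqrt_of_sq_le ?_
    push_cast
    nlinarith [mul_nonneg hm0'.le (Nat.cast_nonneg (α := ℝ) q)]
  have hmq2 : Real.sqrt m * Real.sqrt (m + q : ℕ) ≤ m + q := by
    rw [← Real.sqrt_mul hm0'.le]
    refine Real.sqrt_le_iff.2 ⟨by positivity, ?_⟩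
    push_cast
    nlinarith [mul_nonneg hm0'.le (Nat.cast_nonneg (α := ℝ) q), sq_nonneg (q : ℝ)]
  have hn_eq' : ((k + 1 : ℕ) : ℝ) * m + (m + q) = n := by exact_mod_cast hn_eq
  have hwm : w * Real.sqrt m = ((k + 1 : ℕ) : ℝ) * m + Real.sqrt m * Real.sqrt (m + q : ℕ) := by
    rw [hw, add_mul, mul_assoc, Real.mul_self_sqrt hm0'.le]
    ring
  have hqm' : (q : ℝ) ≤ m := by exact_mod_cast hqm.le
  have hwu : w * Real.sqrt m ≤ n := by linarith
  have hwl : n - m ≤ w * Real.sqrt m := by linarith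
  have htm1 : 1 ≤ t * Real.sqrt m := by
    have h1 : 1 ^ 2 ≤ (t * Real.sqrt m) ^ 2 := by
      rw [mul_pow, Real.sq_sqrt hm0'.le]
      linarith
    exact le_of_sq_le_sq h1 (by positivity)
  have htm2 : t * Real.sqrt m ≤ 1 + t ^ 2 := by
    have h1 : (t * Real.sqrt m) ^ 2 ≤ (1 + t ^ 2) ^ 2 := by
      rw [mul_pow, Real.sq_sqrt hm0'.le]
      nlinarith [sq_nonneg t]
    exact le_of_sq_le_sq h1 (by positivity)
  set θ := w / (n * t) with hθ
  have hnt : 0 < n * t := by positivity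
  have hθ1 : θ ≤ 1 := by
    rw [hθ, div_le_one hnt]
    have h1 : w * Real.sqrt m ≤ n * (t * Real.sqrt m) :=
      hwu.trans (le_mul_of_one_le_right hn.le htm1)
    rw [← mul_assoc] at h1
    exact le_of_mul_le_mul_right h1 hsm
  have hθ2 : 1 - (t ^ 2 + 2 / (n * t ^ 2)) ≤ θ := by
    have hnt2 : 0 < n * t ^ 2 := by positivity
    have h1 : n - m ≤ θ * (n * (1 + t ^ 2)) := by
      have h2 : θ * (n * t) = w := div_mul_cancel₀ _ hnt.ne'
      have hθ0 : 0 ≤ θ := by positivity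
      calc n - m ≤ w * Real.sqrt m := hwl
        _ = θ * (n * (t * Real.sqrt m)) := by rw [← h2]; ring
        _ ≤ θ * (n * (1 + t ^ 2)) := by gcongr
    have h3 : (m : ℝ) ≤ n * (2 / (n * t ^ 2)) := by
      rw [mul_div_assoc', le_div_iff₀ hnt2]
      nlinarith
    have h4 : θ * (n * (1 + t ^ 2)) ≤ n * (θ + t ^ 2) := by
      nlinarith [mul_nonneg hn.le (mul_nonneg (sub_nonneg.2 hθ1) (sq_nonneg t))]
    have h5 : n * (1 - 2 / (n * t ^ 2)) ≤ n * (θ + t ^ 2) := by linarith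
    have h6 := le_of_mul_le_mul_left h5 hn
    linarith
  exact ⟨k, m, q, hmge, hn_eq, hθ1, hθ2⟩

variable {B : Type*} [NormedAddCommGroup B] [NormedSpace ℝ B] [MeasurableSpace B] [BorelSpace B]
  [SecondCountableTopology B]
  {Ω : Type*} [MeasurableSpace Ω] {P : Measure Ω} {X : ℕ → Ω → B}

lemma measure_sum_mem_add_smul_pos (hindep : iIndepFun X P) (hX : ∀ j, Measurable (X j))
    (hident : ∀ j, IdentDistrib (X j) (X 0) P P) {U : Set B} (hU : IsOpen U) (hc : Convex ℝ U)
    {p q : ℕ} {α β : ℝ} (hα : 0 < α) (hβ : 0 < β)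
    (hp : 0 < P {ω | ∑ j ∈ Finset.range p, X j ω ∈ α • U})
    (hq : 0 < P {ω | ∑ j ∈ Finset.range q, X j ω ∈ β • U}) :
    0 < P {ω | ∑ j ∈ Finset.range (p + q), X j ω ∈ (α + β) • U} := by
  have hmα : MeasurableSet (α • U) := (hU.smul₀ hα.ne').measurableSet
  have hmβ : MeasurableSet (β • U) := (hU.smul₀ hβ.ne').measurableSet
  have h1 := measure_inter_sum_Ico hX hindep p (p + q)
    (measurable_sum_range_iSup_comap (X := X) le_rfl hmα) hmβ
  have h2 := (identDistrib_sum_Ico hindep hident p q).measure_mem_eq hmβ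
  have h3 : 0 < P {ω | ∑ j ∈ Finset.Ico p (p + q), X j ω ∈ β • U} := hq.trans_le h2.ge
  have h4 : 0 < P ({ω | ∑ j ∈ Finset.range p, X j ω ∈ α • U} ∩
      {ω | ∑ j ∈ Finset.Ico p (p + q), X j ω ∈ β • U}) :=
    (ENNReal.mul_pos hp.ne' h3.ne').trans_le h1.ge
  refine h4.trans_le (measure_mono fun ω hω => ?_)
  rw [mem_ofPred, hc.add_smul hα.le hβ.le,
    ← Finset.sum_range_add_sum_Ico (fun j => X j ω) (Nat.le_add_right p q)]
  exact add_mem_add hω.1 hω.2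

lemma measure_sum_mem_mul_smul_pos (hindep : iIndepFun X P) (hX : ∀ j, Measurable (X j))
    (hident : ∀ j, IdentDistrib (X j) (X 0) P P) {U : Set B} (hU : IsOpen U) (hc : Convex ℝ U)
    {m : ℕ} {α : ℝ} (hα : 0 < α) (hm : 0 < P {ω | ∑ j ∈ Finset.range m, X j ω ∈ α • U}) (k : ℕ) :
    0 < P {ω | ∑ j ∈ Finset.range ((k + 1) * m), X j ω ∈ ((k + 1 : ℕ) * α) • U} := by
  induction k with
  | zero => simpa using hm
  | succ k ih =>
    have h := measure_sum_mem_add_smul_pos hindep hX hident hU hc (by positivity) hα ih hm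
    rwa [show ((k + 1 : ℕ) : ℝ) * α + α = ((k + 1 + 1 : ℕ) : ℝ) * α by push_cast; ring,
      show (k + 1) * m + m = (k + 1 + 1) * m by ring] at h

variable [IsProbabilityMeasure P] {γ : Measure B} [IsProbabilityMeasure γ]

/-- A moderate deviation into a neighbourhood of a point of the support of the limit law has
positive probability: `n` is cut into about `n s ^ 2` blocks of length about `s ^ (-2)`, and
with positive probability every block sum, normalised by the central limit scaling, lies close to
that point. -/
lemma eventually_measure_sum_mem_pos (hX : ∀ j, Measurable (X j)) (hindep : iIndepFun X P)
    (hident : ∀ j, IdentDistrib (X j) (X 0) P P)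
    (hclt : TendstoInDistribution
      (fun (n : ℕ) (ω : Ω) => (Real.sqrt n)⁻¹ • ∑ j ∈ Finset.range n, X j ω)
      atTop (id : B → B) (fun _ => P) γ)
    {s : ℕ → ℝ} (hpos : ∀ᶠ n in atTop, 0 < s n) (hs0 : Tendsto s atTop (𝓝 0))
    (hs2 : Tendsto (fun n : ℕ => n * s n ^ 2) atTop atTop)
    {D : Set B} {x : B} {r : ℝ} (hr : 0 < r) (hball : Metric.ball x (2 * r) ⊆ D)
    (hγ : 0 < γ (Metric.ball x r)) :
    ∀ᶠ n : ℕ in atTop, 0 < P {ω | (n * s n)⁻¹ • ∑ j ∈ Finset.range n, X j ω ∈ D} := by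
  set U := Metric.ball x r with hU
  obtain ⟨M, hM⟩ := eventually_atTop.1
    ((eventually_lt_measure_of_isOpen hclt Metric.isOpen_ball hγ).and (eventually_gt_atTop 0))
  have hblock : ∀ m, M ≤ m → 0 < P {ω | ∑ j ∈ Finset.range m, X j ω ∈ Real.sqrt m • U} := by
    intro m hm
    have hm0 : 0 < Real.sqrt m := Real.sqrt_pos.2 (by exact_mod_cast (hM m hm).2)
    refine (hM m hm).1.trans_le (measure_mono fun ω hω => ?_)
    rw [mem_ofPred] at hω ⊢
    rwa [mem_smul_set_iff_inv_smul_mem₀ hm0.ne']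
  -- the admissible relative error of the scaling factor
  set e := r / (2 * (‖x‖ + r)) with he
  have he0 : 0 < e := by positivity
  have hs2' : Tendsto (fun n : ℕ => s n ^ 2 + 2 / (n * s n ^ 2)) atTop (𝓝 0) := by
    simpa using (hs0.pow 2).add (hs2.const_div_atTop 2)
  have hinv : Tendsto (fun n => (s n ^ 2)⁻¹) atTop atTop := by
    refine Tendsto.inv_tendsto_nhdsGT_zero (tendsto_nhdsWithin_iff.2 ⟨?_, ?_⟩)
    · simpa using hs0.pow 2
    · filter_upwards [hpos] with n hn
      exact pow_pos hn 2
  filter_upwards [hpos, hs2'.eventually (gt_mem_nhds he0), hs2.eventually_ge_atTop 4,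
    hinv.eventually_ge_atTop (M : ℝ), hs0.eventually (gt_mem_nhds one_pos),
    eventually_gt_atTop 0] with n hsn herr h4 hMn hs1 hn0
  have hn : (0 : ℝ) < n := by exact_mod_cast hn0
  obtain ⟨k, m, q, hmge, hn_eq, hθ1, hθ2⟩ := exists_block_decomposition hsn hs1 h4
  set t := s n with ht
  have hm0' : (0 : ℝ) < m := lt_of_lt_of_le (by positivity) hmge
  have hMm : M ≤ m := by exact_mod_cast hMn.trans hmge
  have hsm : 0 < Real.sqrt m := Real.sqrt_pos.2 hm0'
  have hsmq : 0 < Real.sqrt (m + q : ℕ) :=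
    Real.sqrt_pos.2 (by push_cast; positivity)
  have hP := measure_sum_mem_add_smul_pos hindep hX hident Metric.isOpen_ball (convex_ball x r)
    (by positivity) hsmq
    (measure_sum_mem_mul_smul_pos hindep hX hident Metric.isOpen_ball (convex_ball x r) hsm
      (hblock m hMm) k) (hblock (m + q) (hMm.trans (Nat.le_add_right _ _)))
  rw [hn_eq] at hP
  set w := ((k + 1 : ℕ) : ℝ) * Real.sqrt m + Real.sqrt (m + q : ℕ) with hw
  set θ := w / (n * t) with hθ
  refine hP.trans_le (measure_mono fun ω hω => hball ?_)
  obtain ⟨y, hy, hyω⟩ := mem_ofPred.1 hω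
  simp only at hyω
  have h1 : (n * t)⁻¹ • ∑ j ∈ Finset.range n, X j ω = θ • y := by
    rw [← hyω, smul_smul, hθ, inv_mul_eq_div]
  rw [h1, Metric.mem_ball, dist_eq_norm]
  rw [Metric.mem_ball, dist_eq_norm] at hy
  have h2 : θ • y - x = (y - x) - (1 - θ) • y := by module
  have h3 : ‖y‖ ≤ ‖x‖ + r := by
    have := norm_sub_norm_le y x
    linarith
  have hxr : 0 < ‖x‖ + r := by positivity
  calc ‖θ • y - x‖ ≤ ‖y - x‖ + ‖(1 - θ) • y‖ := by rw [h2]; exact norm_sub_le _ _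
    _ = ‖y - x‖ + (1 - θ) * ‖y‖ := by rw [norm_smul, Real.norm_of_nonneg (by linarith)]
    _ ≤ ‖y - x‖ + e * (‖x‖ + r) := by gcongr; linarith
    _ = ‖y - x‖ + r / 2 := by
        rw [he, div_mul_eq_mul_div, mul_div_mul_right _ _ hxr.ne']
    _ < 2 * r := by linarith

end Positivity

/-! ### Variances under the limit law and the scaling -/

section LimitLaw

variable {B : Type*} [NormedAddCommGroup B] [NormedSpace ℝ B] [MeasurableSpace B] [BorelSpace B]
  {μ γ : Measure B}

/-- The limit law is Gaussian as soon as all its one-dimensional marginals are. -/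
lemma isGaussian_of_map_dual_eq
    (h : ∀ L : StrongDual ℝ B, γ.map L = gaussianReal 0 (∫ x, L x ^ 2 ∂μ).toNNReal) :
    IsGaussian γ :=
  isGaussian_of_map_eq_gaussianReal fun L => ⟨_, _, h L⟩

lemma integral_dual_eq_zero_of_map_eq
    (h : ∀ L : StrongDual ℝ B, γ.map L = gaussianReal 0 (∫ x, L x ^ 2 ∂μ).toNNReal)
    (L : StrongDual ℝ B) : ∫ x, L x ∂γ = 0 := by
  rw [← integral_map (φ := L) (f := fun y : ℝ => y) (by fun_prop) (by fun_prop), h L]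
  simp

lemma integral_sq_eq_of_map_eq
    (h : ∀ L : StrongDual ℝ B, γ.map L = gaussianReal 0 (∫ x, L x ^ 2 ∂μ).toNNReal)
    (L : StrongDual ℝ B) : ∫ x, L x ^ 2 ∂γ = ∫ x, L x ^ 2 ∂μ := by
  rw [← integral_map (φ := L) (f := fun y : ℝ => y ^ 2) (by fun_prop) (by fun_prop), h L]
  have h2 := variance_fun_id_gaussianReal (μ := 0) (v := (∫ x, L x ^ 2 ∂μ).toNNReal)
  rw [variance_of_integral_eq_zero (by fun_prop) (by simp)] at h2
  rw [h2, Real.coe_toNNReal _ (integral_nonneg fun x => sq_nonneg (L x))]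

variable [CompleteSpace B] [SecondCountableTopology B]

/-- The dominating point, computed from the law of the summands. -/
lemma covVec_eq_integral [IsGaussian γ]
    (h : ∀ L : StrongDual ℝ B, γ.map L = gaussianReal 0 (∫ x, L x ^ 2 ∂μ).toNNReal)
    (hexp : ∀ L : StrongDual ℝ B, 0 ∈ interior (integrableExpSet L μ))
    (hLp : MemLp (fun x : B => x) (3 / 2) μ) (g : StrongDual ℝ B) :
    covVec γ g = ∫ x, g x • x ∂μ := by
  refine (SeparatingDual.eq_iff_forall_dual_eq (R := ℝ)).2 fun L => ?_
  rw [dual_covVec, ← L.integral_comp_comm (integrable_apply_smul (hexp g) hLp),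
    integral_mul_eq_of_integral_sq_eq (fun L => IsGaussian.memLp_dual γ L 2 (by simp))
      (fun L => memLp_of_mem_interior_integrableExpSet (hexp L) 2) (integral_sq_eq_of_map_eq h)]
  simp

end LimitLaw

section Scaling

variable {b : ℕ → ℝ}

lemma tendsto_div_nat_zero
    (hb_up : Tendsto (fun n : ℕ => b n / (n : ℝ) ^ ((2 : ℝ) / 3)) atTop (𝓝 0)) :
    Tendsto (fun n : ℕ => b n / n) atTop (𝓝 0) := by
  have h1 : Tendsto (fun n : ℕ => (n : ℝ) ^ (-((1 : ℝ) / 3))) atTop (𝓝 0) :=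
    (tendsto_rpow_neg_atTop (by norm_num)).comp tendsto_natCast_atTop_atTop
  have h2 := hb_up.mul h1
  rw [mul_zero] at h2
  refine h2.congr' ?_
  filter_upwards [eventually_gt_atTop 0] with n hn
  have hn' : (0 : ℝ) < n := by exact_mod_cast hn
  rw [Real.rpow_neg hn'.le, ← div_eq_mul_inv, div_div, ← Real.rpow_add hn']
  norm_num

lemma tendsto_nat_mul_cube
    (hb_up : Tendsto (fun n : ℕ => b n / (n : ℝ) ^ ((2 : ℝ) / 3)) atTop (𝓝 0)) :
    Tendsto (fun n : ℕ => n * (b n / n) ^ 3) atTop (𝓝 0) := by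
  have h2 := hb_up.pow 3
  rw [zero_pow (by norm_num)] at h2
  refine h2.congr' ?_
  filter_upwards [eventually_gt_atTop 0] with n hn
  have hn' : (0 : ℝ) < n := by exact_mod_cast hn
  rw [div_pow, ← Real.rpow_natCast ((n : ℝ) ^ ((2 : ℝ) / 3)), ← Real.rpow_mul hn'.le]
  norm_num
  field_simp

lemma tendsto_nat_mul_sq
    (hb_low : Tendsto (fun n : ℕ => b n / (n : ℝ) ^ ((1 : ℝ) / 2)) atTop atTop) :
    Tendsto (fun n : ℕ => n * (b n / n) ^ 2) atTop atTop := by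
  have h2 := (tendsto_pow_atTop two_ne_zero).comp hb_low
  refine h2.congr' ?_
  filter_upwards [eventually_gt_atTop 0] with n hn
  have hn' : (0 : ℝ) < n := by exact_mod_cast hn
  simp only [Function.comp]
  rw [div_pow, ← Real.rpow_natCast ((n : ℝ) ^ ((1 : ℝ) / 2)), ← Real.rpow_mul hn'.le]
  norm_num
  field_simp

lemma scaledSum_mem_smul_iff {B : Type*} [NormedAddCommGroup B] [NormedSpace ℝ B] {n : ℕ} {β : ℝ}
    (hn : 0 < n) (hβ : 0 < β) (z : Fin n → B) (D : Set B) :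
    scaledSum n (β / n) z ∈ (β ^ 2 / (n : ℝ)) • D ↔ β⁻¹ • ∑ j, z j ∈ D := by
  have hn' : (0 : ℝ) < n := by exact_mod_cast hn
  rw [mem_smul_set_iff_inv_smul_mem₀ (by positivity), scaledSum, smul_smul]
  congr! 2
  field_simp

end Scaling

end ModDev

/-! ### The asymptotic representation -/

theorem theorem1
    {B : Type*} [NormedAddCommGroup B] [NormedSpace ℝ B] [CompleteSpace B]
    [SecondCountableTopology B] [MeasurableSpace B] [BorelSpace B]
    {Ω : Type*} [MeasurableSpace Ω] (P : Measure Ω) [IsProbabilityMeasure P]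
    (X : ℕ → Ω → B) (hX : ∀ j, Measurable (X j)) (hindep : iIndepFun X P)
    (hident : ∀ j, IdentDistrib (X j) (X 0) P P)
    (γ : Measure B) [IsProbabilityMeasure γ] (hnondeg : ∀ c : B, γ ≠ Measure.dirac c)
    (hclt : TendstoInDistribution
      (fun (n : ℕ) (ω : Ω) => (Real.sqrt n)⁻¹ • ∑ j ∈ Finset.range n, X j ω)
      atTop (id : B → B) (fun _ => P) γ)
    (b : ℕ → ℝ) (hb : ∀ n, 1 ≤ n → 0 < b n)
    (hb_low : Tendsto (fun n : ℕ => b n / (n : ℝ) ^ ((1 : ℝ) / 2)) atTop atTop)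
    (hb_up : Tendsto (fun n : ℕ => b n / (n : ℝ) ^ ((2 : ℝ) / 3)) atTop (𝓝 0))
    (hexp : ∀ f : StrongDual ℝ B, ∃ tf : ℝ, 0 < tf ∧ ∀ t : ℝ, 0 < |t| → |t| < tf →
      Integrable (fun ω => Real.exp (t * |f (X 0 ω)|)) P)
    (D : Set B) (hD : ModDev.IsAdmissible γ D)
    (a₀ : B) (ha₀ : ModDev.IsDominatingPoint γ D a₀)
    (f g : StrongDual ℝ B) (hf : ModDev.Separates γ D a₀ f)
    (t₀ : ℝ) (ht₀ : 0 < t₀) (hg_eq : g = t₀ • f)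
    (hg : ModDev.IsDominatingFunctional γ D a₀ g) :
    -- for large `n` the tilted law is a well-defined probability measure with a mean
    (∀ᶠ n : ℕ in atTop,
      IsProbabilityMeasure (ModDev.tiltedLaw (P.map (X 0)) g (b n / n)) ∧
      Integrable (fun x : B => x) (ModDev.tiltedLaw (P.map (X 0)) g (b n / n))) ∧
    -- the asymptotic representation
    Tendsto (fun n : ℕ =>
        P.real {ω | (b n)⁻¹ • ∑ j ∈ Finset.range n, X j ω ∈ D} /
          (Real.exp (-((b n) ^ 2 / n * (ModDev.rate γ a₀).toReal)) *
            ModDev.tiltedExpectation (P.map (X 0)) g (b n / n) n (((b n) ^ 2 / (n : ℝ)) • D)))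
      atTop (𝓝 1) ∧
    -- the mean of the tilted law
    (fun n : ℕ => (∫ x, x ∂(ModDev.tiltedLaw (P.map (X 0)) g (b n / n))) - (b n / n) • a₀)
      =O[atTop] (fun n : ℕ => (b n) ^ 2 / (n : ℝ) ^ 2) ∧
    -- the upper bound, with a positive limiting variance
    0 < ∫ ω, (g (X 0 ω)) ^ 2 ∂P ∧
    limsup (fun n : ℕ => (((n : ℝ) ^ (-(1 : ℝ) / 2) * b n *
        P.real {ω | (b n)⁻¹ • ∑ j ∈ Finset.range n, X j ω ∈ D} *
        Real.exp ((b n) ^ 2 / n * (ModDev.rate γ a₀).toReal) : ℝ) : EReal)) atTop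
      ≤ (((2 * Real.pi * ∫ ω, (g (X 0 ω)) ^ 2 ∂P) ^ (-(1 : ℝ) / 2) : ℝ) : EReal) := by
  have hX0 : AEMeasurable (X 0) P := (hX 0).aemeasurable
  set μ : Measure B := P.map (X 0) with hμ
  have hμp : IsProbabilityMeasure μ := Measure.isProbabilityMeasure_map hX0
  -- moments of the summands
  have hexpμ : ∀ L : StrongDual ℝ B, 0 ∈ interior (integrableExpSet L μ) := by
    intro L
    obtain ⟨tf, htf, h⟩ := hexp L
    refine ModDev.zero_mem_interior_integrableExpSet (by fun_prop)
      ⟨tf, htf, fun t ht0 ht => ?_⟩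
    rw [hμ, integrable_map_measure (by fun_prop) hX0]
    exact h t ht0 ht
  have hLp : MemLp (fun x : B => x) (3 / 2) μ := by
    rw [hμ, memLp_map_measure_iff (by fun_prop) hX0]
    exact ModDev.memLp_three_halves hX hindep hident hclt
  have hmean : ∫ x, x ∂μ = 0 := by
    rw [hμ, integral_map hX0 (by fun_prop)]
    exact ModDev.integral_eq_zero_of_clt hX hindep hident hclt
  have hg0 : ∫ x, g x ∂μ = 0 := by
    have hint : Integrable (fun x : B => x) μ :=
      hLp.integrable (by rw [ENNReal.le_div_iff_mul_le] <;> norm_num)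
    rw [g.integral_comp_comm hint, hmean, map_zero]
  have hsqP : ∀ L : StrongDual ℝ B, ∫ ω, L (X 0 ω) ^ 2 ∂P = ∫ x, L x ^ 2 ∂μ := fun L => by
    rw [hμ, integral_map hX0 (by fun_prop)]
  -- the limit law
  have hmap : ∀ L : StrongDual ℝ B, γ.map L = gaussianReal 0 (∫ x, L x ^ 2 ∂μ).toNNReal := by
    intro L
    rw [← hsqP]
    refine ModDev.map_dual_eq_of_clt hX hindep hident hclt L ?_
    have h2 := memLp_of_mem_interior_integrableExpSet (hexpμ L) 2
    rw [hμ, memLp_map_measure_iff (by fun_prop) hX0] at h2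
    exact h2
  have hγG : IsGaussian γ := ModDev.isGaussian_of_map_dual_eq hmap
  have hγ0 := ModDev.integral_dual_eq_zero_of_map_eq hmap
  have hγsq := ModDev.integral_sq_eq_of_map_eq hmap
  rw [hsqP]
  set σ := ∫ x, g x ^ 2 ∂μ with hσdef
  have ha₀eq : a₀ = ∫ x, g x • x ∂μ := by
    rw [hg.eq_covVec hγ0, ModDev.covVec_eq_integral hmap hexpμ hLp]
  have hga₀ : g a₀ = σ := by
    rw [hg.eq_covVec hγ0, ModDev.dual_covVec, hσdef, ← hγsq]
    simp [sq]
  have hrate : (ModDev.rate γ a₀).toReal = σ / 2 := by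
    rw [hg.rate_eq_half hγ0, EReal.toReal_coe, hγsq]
  have hσ : 0 < σ := by
    refine lt_of_le_of_ne (integral_nonneg fun x => sq_nonneg (g x)) fun h0 => hD.zero_notMem ?_
    have h1 : (fun x => g x ^ 2) =ᵐ[μ] 0 :=
      (integral_eq_zero_iff_of_nonneg (fun x => sq_nonneg (g x))
        (memLp_of_mem_interior_integrableExpSet (hexpμ g) 2).integrable_sq).1 h0.symm
    have h2 : a₀ = 0 := by
      rw [ha₀eq]
      refine integral_eq_zero_of_ae ?_
      filter_upwards [h1] with x hx
      simp [pow_eq_zero_iff two_ne_zero |>.1 hx]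
    rw [← h2]
    exact frontier_subset_closure ha₀.mem_frontier
  -- the scaling
  set s : ℕ → ℝ := fun n => b n / n with hs
  have hs0 : Tendsto s atTop (𝓝 0) := ModDev.tendsto_div_nat_zero hb_up
  have hs3 : Tendsto (fun n : ℕ => n * s n ^ 3) atTop (𝓝 0) := ModDev.tendsto_nat_mul_cube hb_up
  have hs2 : Tendsto (fun n : ℕ => n * s n ^ 2) atTop atTop := ModDev.tendsto_nat_mul_sq hb_low
  have hspos : ∀ᶠ n in atTop, 0 < s n := by
    filter_upwards [eventually_ge_atTop 1] with n hn
    exact div_pos (hb n hn) (by exact_mod_cast hn)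
  have hsmem : ∀ᶠ n in atTop, s n ∈ interior (integrableExpSet g μ) :=
    hs0.eventually (isOpen_interior.mem_nhds (hexpμ g))
  have hsint := hs0.eventually (ModDev.eventually_integrable_tiltedLaw (hexpμ g) hLp)
  set TE : ℕ → ℝ := fun n =>
    ModDev.tiltedExpectation μ g (s n) n ((b n ^ 2 / (n : ℝ)) • D) with hTE
  set p : ℕ → ℝ := fun n => P.real {ω | (b n)⁻¹ • ∑ j ∈ Finset.range n, X j ω ∈ D} with hp
  -- the exponent left over by the change of measure is negligible
  set e : ℕ → ℝ := fun n =>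
    n * (cgf g μ (s n) - s n * deriv (cgf g μ) (s n) + s n ^ 2 * σ / 2) with he
  have he0 : Tendsto e atTop (𝓝 0) := by
    have h1 := (ModDev.cgf_sub_mul_deriv_isBigO (hexpμ g) hg0).comp_tendsto hs0
    have h2 := (Asymptotics.isBigO_refl (fun n : ℕ => (n : ℝ)) atTop).mul h1
    exact h2.trans_tendsto hs3
  have hexact : ∀ᶠ n in atTop,
      p n = Real.exp (e n) * Real.exp (-(b n ^ 2 / n * (σ / 2))) * TE n := by
    filter_upwards [hsmem, hsint, eventually_gt_atTop 0] with n h1 h2 hn0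
    have hn' : (0 : ℝ) < n := by exact_mod_cast hn0
    have hbn := hb n hn0
    have hA : MeasurableSet ((b n ^ 2 / (n : ℝ)) • D) :=
      (hD.isOpen.smul₀ (by positivity)).measurableSet
    have h3 := ModDev.measureReal_eq_exp_mul_tiltedExpectation h1 h2 n hA
    have hpi : P.map (fun ω (i : Fin n) => X i ω) = Measure.pi fun _ : Fin n => μ := by
      rw [(iIndepFun_iff_map_fun_eq_pi_map fun i : Fin n => (hX i).aemeasurable).1
        (hindep.precomp (g := fun i : Fin n => (i : ℕ)) Fin.val_injective)]
      congr 1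
      funext i
      exact (hident i).map_eq
    have h4 : (Measure.pi fun _ : Fin n => μ).real
        {z | ModDev.scaledSum n (s n) z ∈ (b n ^ 2 / (n : ℝ)) • D} = p n := by
      have hset : {z : Fin n → B | ModDev.scaledSum n (s n) z ∈ (b n ^ 2 / (n : ℝ)) • D} =
          {z | (b n)⁻¹ • ∑ j, z j ∈ D} := by
        ext z
        exact ModDev.scaledSum_mem_smul_iff hn0 hbn z D
      have hm : MeasurableSet {z : Fin n → B | (b n)⁻¹ • ∑ j, z j ∈ D} := by
        have : Measurable fun z : Fin n → B => (b n)⁻¹ • ∑ j, z j := by fun_prop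
        exact this hD.isOpen.measurableSet
      rw [hset, ← hpi, map_measureReal_apply (by fun_prop) hm]
      simp only [preimage_ofPred_eq, hp, Finset.sum_range]
    rw [← h4, h3, ← Real.exp_add]
    congr 2
    simp only [he, hs]
    field_simp
    ring
  -- the probabilities do not vanish, so that the ratio is meaningful
  have hppos : ∀ᶠ n in atTop, 0 < p n := by
    obtain ⟨x, hxD, hxH⟩ := hD.inter_nonempty
    obtain ⟨r, hr, hball⟩ := Metric.isOpen_iff.1 hD.isOpen x hxD
    have h1 := ModDev.eventually_measure_sum_mem_pos hX hindep hident hclt hspos hs0 hs2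
      (half_pos hr) (D := D) (x := x) (by rw [mul_div_cancel₀ r two_ne_zero]; exact hball)
      (ModDev.measure_pos_of_inter_generatingSpace hγ0 Metric.isOpen_ball
        ⟨x, Metric.mem_ball_self (half_pos hr), hxH⟩)
    filter_upwards [h1, eventually_gt_atTop 0] with n hn hn0
    have hn' : (n : ℝ) ≠ 0 := by exact_mod_cast hn0.ne'
    simp only [hs] at hn
    rw [mul_div_cancel₀ _ hn'] at hn
    exact ENNReal.toReal_pos hn.ne' (measure_ne_top _ _)
  refine ⟨?_, ?_, ?_, hσ, ?_⟩
  · filter_upwards [hsmem, hsint] with n h1 h2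
    refine ⟨?_, h2⟩
    rw [ModDev.tiltedLaw_eq]
    exact isProbabilityMeasure_tilted (interior_subset (s := integrableExpSet g μ) h1)
  · have h1 : Tendsto (fun n => Real.exp (e n)) atTop (𝓝 1) := by
      simpa using he0.rexp
    refine h1.congr' ?_
    filter_upwards [hexact, hppos] with n hn hpn
    change _ = p n / (Real.exp (-(b n ^ 2 / n * (ModDev.rate γ a₀).toReal)) * TE n)
    rw [hrate]
    have h2 : TE n ≠ 0 := by
      intro h0
      rw [h0, mul_zero] at hn
      exact hpn.ne' hn
    rw [hn, mul_assoc, mul_div_assoc, div_self (mul_ne_zero (Real.exp_pos _).ne' h2), mul_one]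
  · rw [ha₀eq]
    have h1 := (ModDev.integral_tiltedLaw_sub_isBigO (hexpμ g) hLp hmean).comp_tendsto hs0
    refine h1.congr_right fun n => ?_
    simp only [Function.comp, hs, div_pow]
  · have hr : (2 * Real.pi * σ) ^ (-(1 : ℝ) / 2) = (Real.sqrt (2 * Real.pi * σ))⁻¹ := by
      rw [neg_div, Real.rpow_neg (by positivity), Real.sqrt_eq_rpow]
    rw [hr]
    refine le_of_forall_gt_imp_ge_of_dense fun c hc => ?_
    obtain ⟨C, hC1, hC2⟩ := EReal.lt_iff_exists_real_btwn.1 hc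
    refine le_trans ?_ hC2.le
    rw [EReal.coe_lt_coe_iff] at hC1
    obtain ⟨C', hC1', hC2'⟩ := exists_between hC1
    have hC'0 : 0 < C' := lt_of_le_of_lt (by positivity) hC1'
    have hbound := ModDev.eventually_mul_tiltedExpectation_le (A := fun n : ℕ =>
      (b n ^ 2 / (n : ℝ)) • D) (hexpμ g) hLp hg0 hσ hspos hs0 hs3 (by
        filter_upwards [eventually_gt_atTop 0] with n hn0 x hx
        have hn' : (0 : ℝ) < n := by exact_mod_cast hn0
        obtain ⟨d, hd, rfl⟩ := hx
        have h1 := hg.subset_halfSpace hd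
        rw [mem_ofPred, hga₀] at h1
        simp only [map_smul, smul_eq_mul]
        have h2 : n * s n ^ 2 = b n ^ 2 / n := by
          simp only [hs]
          field_simp
        rw [h2]
        gcongr) hC1'
    have hexpC : ∀ᶠ n in atTop, Real.exp (e n) * C' ≤ C := by
      have h1 : Tendsto (fun n => Real.exp (e n) * C') atTop (𝓝 (1 * C')) :=
        Tendsto.mul_const _ (by simpa using he0.rexp)
      rw [one_mul] at h1
      exact (h1.eventually (gt_mem_nhds hC2')).mono fun n hn => hn.le
    refine limsup_le_of_le (by isBoundedDefault) ?_
    filter_upwards [hexact, hbound, hexpC, eventually_gt_atTop 0] with n h1 h2 h3 hn0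
    have hn' : (0 : ℝ) < n := by exact_mod_cast hn0
    rw [EReal.coe_le_coe_iff]
    change (n : ℝ) ^ (-(1 : ℝ) / 2) * b n * p n *
      Real.exp (b n ^ 2 / n * (ModDev.rate γ a₀).toReal) ≤ C
    have h4 : (n : ℝ) ^ (-(1 : ℝ) / 2) * b n = s n * Real.sqrt n := by
      rw [neg_div, Real.rpow_neg hn'.le, ← Real.sqrt_eq_rpow]
      simp only [hs]
      have h5 : 0 < Real.sqrt n := Real.sqrt_pos.2 hn'
      have h6 := Real.mul_self_sqrt hn'.le
      field_simp
      rw [sq, h6, mul_comm]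
    rw [h4, hrate, h1]
    calc s n * Real.sqrt n * (Real.exp (e n) * Real.exp (-(b n ^ 2 / n * (σ / 2))) * TE n) *
          Real.exp (b n ^ 2 / n * (σ / 2))
        = Real.exp (e n) * (s n * Real.sqrt n * TE n) *
          (Real.exp (-(b n ^ 2 / n * (σ / 2))) * Real.exp (b n ^ 2 / n * (σ / 2))) := by ring
      _ = Real.exp (e n) * (s n * Real.sqrt n * TE n) := by
          rw [← Real.exp_add, neg_add_cancel, Real.exp_zero, mul_one]
      _ ≤ Real.exp (e n) * C' := by gcongr
      _ ≤ C := h3
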